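/- Notation. Let $\mathbb{H}$ be the upper half plane, $E_2(\tau)=1-24\sum_{n\ge1}\sigma_1(n)e^{2\pi\sqrt{-1}n\tau}$, $f^\infty(\tau)=-\frac1{24}E_2(\tau)$, and $\rho=e^{2\pi\sqrt{-1}/3}$. An invertible matrix $A=\begin{pmatrix}a&b\\c&d\end{pmatrix}$ acts on functions by $f^A(t)=\frac{\det A}{(ct+d)^2}f\!\left(\frac{at+b}{ct+d}\right)+\frac{c}{2(ct+d)}$. For $\tau_0\in\mathbb{H}$ and $\omega_0\in\mathbb{C}\setminus\{0\}$ let $D^{(\tau_0,\omega_0)}=\{t\in\mathbb{C}: |t|<|-4\pi\omega_0^2\,\mathrm{Im}(\tau_0)|\}$, and let $f^{(\tau_0,\omega_0)}:D^{(\tau_0,\omega_0)}\to\mathbb{C}$ be the holomorphic function obtained by applying to $2\pi\sqrt{-1}f^\infty$ the matrix $$A^{(\tau_0,\omega_0)}=\begin{pmatrix}\frac{\bar\tau_0}{4\pi\omega_0\mathrm{Im}(\tau_0)}&\omega_0\tau_0\\ \frac{1}{4\pi\omega_0\mathrm{Im}(\tau_0)}&\omega_0\end{pmatrix}.$$ Let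 $M^{(\tau_0,\omega_0)}=\mathbb{C}^2\times D^{(\tau_0,\omega_0)}$, with flat coordinates $(t_1,t_2,t)$, unit field $e=\partial_{t_1}$, Euler field $E=t_1\partial_{t_1}+\frac12t_2\partial_{t_2}$, and metric $\eta$ and product $\circ$ given by the potential $\mathcal F=\frac12t_1^2t+t_1t_2^2+t_2^4f^{(\tau_0,\omega_0)}(t)$, that is, $\eta(\partial_i,\partial_j)=\partial_{t_1}\partial_i\partial_j\mathcal F$ and $\eta(\partial_i\circ\partial_j,\partial_k)=\partial_i\partial_j\partial_k\mathcal F$. An isomorphism of Frobenius manifolds is a biholomorphic map whose differential preserves $\eta$, $\circ$, $e$ and $E$. Proposition. Let $\tau_0,\tau_1\in\mathbb{H}$ and $\omega_0,\omega_1\in\mathbb{C}\setminus\{0\}$. Then $M^{(\tau_0,\omega_0)}$ and $M^{(\tau_1,\omega_1)}$ are Frobenius manifolds of rank three and dimension one, and the following are equivalent: 1. There is an isomorphism of Frobenius manifolds $M^{(\tau_0,\omega_0)}\cong M^{(\tau_1,\omega_1)}$. 2. The equality $f^{(\tau_0,\omega_0)}(t)=f^{(\tau_1,\omega_1)}(t)$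 holds, in either of the following two senses, which are themselves equivalent: (a) the two functions have the same disc as domain and agree on it; (b) they agree on a neighbourhood of $t=0$, i.e. have the same Taylor series at $0$. 3. There is an element $\begin{pmatrix}a&b\\c&d\end{pmatrix}\in\mathrm{SL}(2,\mathbb{Z})$ such that $$\tau_1=\frac{a\tau_0+b}{c\tau_0+d},\qquad \omega_1^k=(c\tau_0+d)^k\omega_0^k,$$ where $k=4$ if $\tau_0\in\mathrm{SL}(2,\mathbb{Z})\sqrt{-1}$, $k=6$ if $\tau_0\in\mathrm{SL}(2,\mathbb{Z})\rho$, and $k=2$ otherwise. -/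

import Mathlib

open scoped UpperHalfPlane MatrixGroups Topology

noncomputable section

namespace FrobeniusManifolds

/-! ### Frobenius structures on open subsets of coordinate space

A vector field on an open set `U ⊆ ℂ^ι` is a map `U → (ι → ℂ)`.  Tensor fields are given by their
values at the points of `U`, which are linear or bilinear maps.  Only values at points of `domain`
matter. -/

/-- The data `(M, η, ∘, e, E)` underlying a Frobenius structure on an open set of `ℂ^ι`. -/
structure FrobeniusData (ι : Type*) where
  /-- The underlying manifold `M`. -/
  domain : Set (ι → ℂ)
  /-- The bilinear form `η` on tangent vectors. -/
  metric : (ι → ℂ) → (ι → ℂ) →ₗ[ℂ] (ι → ℂ) →ₗ[ℂ] ℂ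
  /-- The product `∘` on tangent vectors. -/
  mul : (ι → ℂ) → (ι → ℂ) →ₗ[ℂ] (ι → ℂ) →ₗ[ℂ] (ι → ℂ)
  /-- The unit vector field `e`. -/
  unit : (ι → ℂ) → (ι → ℂ)
  /-- The Euler vector field `E`. -/
  euler : (ι → ℂ) → (ι → ℂ)

variable {ι : Type*} [Fintype ι]

/-- `Γ` gives the Christoffel symbols of the Levi-Civita connection
`∇_u Y = D_u Y + Γ(u, Y)` of the metric on the domain: `Γ` is holomorphic, torsion free and
compatible with the metric.  (For a non-degenerate metric, such a `Γ` is unique on the domain.) -/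
structure IsLeviCivita (M : FrobeniusData ι)
    (Γ : (ι → ℂ) → (ι → ℂ) →ₗ[ℂ] (ι → ℂ) →ₗ[ℂ] (ι → ℂ)) : Prop where
  holo : ∀ v w, DifferentiableOn ℂ (fun x => Γ x v w) M.domain
  torsion_free : ∀ x ∈ M.domain, ∀ v w, Γ x v w = Γ x w v
  compatible : ∀ x ∈ M.domain, ∀ u v w,
    fderiv ℂ (fun y => M.metric y v w) x u = M.metric x (Γ x u v) w + M.metric x v (Γ x u w)

/-- The data `M` is a Frobenius manifold of dimension (charge) `d`; its rank is the number of
coordinates.  All tensor identities are evaluated on constant coordinate vector fields. -/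
structure IsFrobenius (M : FrobeniusData ι) (d : ℂ) : Prop where
  isOpen_domain : IsOpen M.domain
  isConnected_domain : IsConnected M.domain
  metric_holo : ∀ v w, DifferentiableOn ℂ (fun x => M.metric x v w) M.domain
  mul_holo : ∀ v w, DifferentiableOn ℂ (fun x => M.mul x v w) M.domain
  unit_holo : DifferentiableOn ℂ M.unit M.domain
  euler_holo : DifferentiableOn ℂ M.euler M.domain
  metric_symm : ∀ x ∈ M.domain, ∀ v w, M.metric x v w = M.metric x w v
  metric_nondeg : ∀ x ∈ M.domain, ∀ v, (∀ w, M.metric x v w = 0) → v = 0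
  mul_comm : ∀ x ∈ M.domain, ∀ v w, M.mul x v w = M.mul x w v
  mul_assoc : ∀ x ∈ M.domain, ∀ u v w, M.mul x (M.mul x u v) w = M.mul x u (M.mul x v w)
  unit_mul : ∀ x ∈ M.domain, ∀ v, M.mul x (M.unit x) v = v
  /-- The product is self-adjoint with respect to the metric. -/
  invariant : ∀ x ∈ M.domain, ∀ u v w, M.metric x (M.mul x u v) w = M.metric x u (M.mul x v w)
  /-- The Levi-Civita connection is flat, the tensor `C` with `C_u v = u ∘ v` satisfies `∇ C = 0`
  as an endomorphism-valued one-form, that is `(∇_u C)_v = (∇_v C)_u`, and `∇ e = 0`. -/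
  connection : ∃ Γ : (ι → ℂ) → (ι → ℂ) →ₗ[ℂ] (ι → ℂ) →ₗ[ℂ] (ι → ℂ), IsLeviCivita M Γ ∧
    (∀ x ∈ M.domain, ∀ u v w,
      fderiv ℂ (fun y => Γ y v w) x u - fderiv ℂ (fun y => Γ y u w) x v
        + Γ x u (Γ x v w) - Γ x v (Γ x u w) = 0) ∧
    (∀ x ∈ M.domain, ∀ u v w,
      fderiv ℂ (fun y => M.mul y v w) x u + Γ x u (M.mul x v w)
          - M.mul x (Γ x u v) w - M.mul x v (Γ x u w)
        = fderiv ℂ (fun y => M.mul y u w) x v + Γ x v (M.mul x u w)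
          - M.mul x (Γ x v u) w - M.mul x u (Γ x v w)) ∧
    (∀ x ∈ M.domain, ∀ u, fderiv ℂ M.unit x u + Γ x u (M.unit x) = 0)
  /-- `Lie_E η = (2 - d) η`. -/
  lie_metric : ∀ x ∈ M.domain, ∀ v w,
    fderiv ℂ (fun y => M.metric y v w) x (M.euler x)
        + M.metric x (fderiv ℂ M.euler x v) w + M.metric x v (fderiv ℂ M.euler x w)
      = (2 - d) * M.metric x v w
  /-- `Lie_E ∘ = ∘`. -/
  lie_mul : ∀ x ∈ M.domain, ∀ v w,
    fderiv ℂ (fun y => M.mul y v w) x (M.euler x) - fderiv ℂ M.euler x (M.mul x v w)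
        + M.mul x (fderiv ℂ M.euler x v) w + M.mul x v (fderiv ℂ M.euler x w)
      = M.mul x v w

/-- Isomorphism of Frobenius manifolds: a biholomorphic map `φ` of the underlying manifolds (with
inverse `ψ`) whose differential carries `η`, `∘`, `e`, `E` of `M` to those of `N`. -/
def Isomorphic (M N : FrobeniusData ι) : Prop :=
  ∃ φ ψ : (ι → ℂ) → (ι → ℂ),
    Set.MapsTo φ M.domain N.domain ∧ Set.MapsTo ψ N.domain M.domain ∧
    Set.LeftInvOn ψ φ M.domain ∧ Set.RightInvOn ψ φ N.domain ∧
    DifferentiableOn ℂ φ M.domain ∧ DifferentiableOn ℂ ψ N.domain ∧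
    ∀ x ∈ M.domain,
      (∀ v w, N.metric (φ x) (fderiv ℂ φ x v) (fderiv ℂ φ x w) = M.metric x v w) ∧
      (∀ v w, fderiv ℂ φ x (M.mul x v w) = N.mul (φ x) (fderiv ℂ φ x v) (fderiv ℂ φ x w)) ∧
      fderiv ℂ φ x (M.unit x) = N.unit (φ x) ∧
      fderiv ℂ φ x (M.euler x) = N.euler (φ x)

/-! ### The structure given by a potential in flat coordinates -/

variable [DecidableEq ι]

/-- The partial derivative `∂F/∂t_i`. -/
def pderiv (i : ι) (F : (ι → ℂ) → ℂ) : (ι → ℂ) → ℂ :=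
  fun x => fderiv ℂ F x (Pi.single i 1)

/-- `∂_i ∂_j ∂_k F`. -/
def pderiv₃ (F : (ι → ℂ) → ℂ) (i j k : ι) : (ι → ℂ) → ℂ :=
  pderiv i (pderiv j (pderiv k F))

/-- The matrix `η_{ij} = ∂_{i₀} ∂_i ∂_j F`, where `∂_{i₀}` is the unit field. -/
def etaMatrix (F : (ι → ℂ) → ℂ) (i₀ : ι) (x : ι → ℂ) : Matrix ι ι ℂ :=
  Matrix.of fun i j => pderiv₃ F i₀ i j x

/-- The structure constants `c_{ij}^k = ∑_l η^{kl} ∂_i ∂_j ∂_l F`. -/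
def structConst (F : (ι → ℂ) → ℂ) (i₀ : ι) (x : ι → ℂ) (i j k : ι) : ℂ :=
  ∑ l, (etaMatrix F i₀ x)⁻¹ k l * pderiv₃ F i j l x

/-- The data on `U` given by the potential `F` in the flat coordinates, with unit field
`∂_{i₀}` and Euler field `E`: `η(∂_i, ∂_j) = η_{ij}` and `∂_i ∘ ∂_j = ∑_k c_{ij}^k ∂_k`. -/
def ofPotential (U : Set (ι → ℂ)) (F : (ι → ℂ) → ℂ) (i₀ : ι) (E : (ι → ℂ) → (ι → ℂ)) :
    FrobeniusData ι where
  domain := U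
  metric x := LinearMap.mk₂ ℂ (fun v w => ∑ i, ∑ j, v i * w j * etaMatrix F i₀ x i j)
    (by intros; simp [add_mul, Finset.sum_add_distrib])
    (by intros; simp [Finset.mul_sum, mul_assoc])
    (by intros; simp [mul_add, add_mul, Finset.sum_add_distrib])
    (by intros; simp [Finset.mul_sum, mul_assoc, mul_left_comm])
  mul x := LinearMap.mk₂ ℂ (fun v w k => ∑ i, ∑ j, v i * w j * structConst F i₀ x i j k)
    (by intros; funext k; simp [add_mul, Finset.sum_add_distrib])
    (by intros; funext k; simp [Finset.mul_sum, mul_assoc])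
    (by intros; funext k; simp [mul_add, add_mul, Finset.sum_add_distrib])
    (by intros; funext k; simp [Finset.mul_sum, mul_assoc, mul_left_comm])
  unit _ := Pi.single i₀ 1
  euler := E

/-! ### The Frobenius manifolds `M^{(τ,ω)}` of rank three and dimension one -/

/-- `f^∞(τ) = -E₂(τ)/24` for `Im τ > 0`. -/
def fInfty (τ : ℂ) : ℂ := -(1 / 24) * EisensteinSeries.E2 (UpperHalfPlane.ofComplex τ)

/-- The action `f ↦ f^A` of an invertible `2 × 2` matrix `A`. -/
def glAct (A : Matrix (Fin 2) (Fin 2) ℂ) (f : ℂ → ℂ) (t : ℂ) : ℂ :=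
  A.det / (A 1 0 * t + A 1 1) ^ 2 * f ((A 0 0 * t + A 0 1) / (A 1 0 * t + A 1 1))
    + A 1 0 / (2 * (A 1 0 * t + A 1 1))

/-- The matrix `A^{(τ,ω)}`. -/
def matA (τ : ℍ) (ω : ℂ) : Matrix (Fin 2) (Fin 2) ℂ :=
  !![(starRingEnd ℂ) (τ : ℂ) / (4 * Real.pi * ω * τ.im), ω * τ;
     1 / (4 * Real.pi * ω * τ.im), ω]

/-- The disc `|t| < |-4π ω² Im τ|`, the domain of `f^{(τ,ω)}`. -/
def disc (τ : ℍ) (ω : ℂ) : Set ℂ :=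
  {t | ‖t‖ < ‖-4 * (Real.pi : ℂ) * ω ^ 2 * (τ.im : ℂ)‖}

/-- The function `f^{(τ,ω)}`: the matrix `A^{(τ,ω)}` acting on `2πi f^∞`.  It is considered on
`disc τ ω` only. -/
def fFun (τ : ℍ) (ω : ℂ) : ℂ → ℂ :=
  glAct (matA τ ω) (fun z => 2 * Real.pi * Complex.I * fInfty z)

/-- The potential `½ t₁² t + t₁ t₂² + t₂⁴ f^{(τ,ω)}(t)` in the coordinates `(t₁, t₂, t)`. -/
def potential (τ : ℍ) (ω : ℂ) (x : Fin 3 → ℂ) : ℂ :=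
  1 / 2 * x 0 ^ 2 * x 2 + x 0 * x 1 ^ 2 + x 1 ^ 4 * fFun τ ω (x 2)

/-- The Frobenius manifold `M^{(τ,ω)} = ℂ² × disc`, with unit field `∂/∂t₁` and Euler field
`t₁ ∂/∂t₁ + ½ t₂ ∂/∂t₂`. -/
def frobM (τ : ℍ) (ω : ℂ) : FrobeniusData (Fin 3) :=
  ofPotential {x | x 2 ∈ disc τ ω} (potential τ ω) 0 (fun x => ![x 0, 1 / 2 * x 1, 0])

/-! ### The exponent `k` -/

/-- `ρ = exp(2πi/3)` as a point of the upper half plane. -/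
def rho : ℍ := ⟨Complex.exp (2 * Real.pi * Complex.I / 3), by
  have h : (2 * Real.pi * Complex.I / 3 : ℂ) = ((2 * Real.pi / 3 : ℝ) : ℂ) * Complex.I := by
    push_cast; ring
  rw [h, Complex.exp_ofReal_mul_I_im]
  apply Real.sin_pos_of_pos_of_lt_pi <;> linarith [Real.pi_pos]⟩

open Classical in
/-- `k = 4` on the orbit of `i`, `k = 6` on the orbit of `ρ`, and `k = 2` otherwise. -/
def kExp (τ : ℍ) : ℕ :=
  if τ ∈ MulAction.orbit SL(2, ℤ) UpperHalfPlane.I then 4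
  else if τ ∈ MulAction.orbit SL(2, ℤ) rho then 6
  else 2

end FrobeniusManifolds

end

open scoped UpperHalfPlane MatrixGroups Topology

noncomputable section

namespace FrobeniusManifolds

open Filter UpperHalfPlane

/-! The action f ↦ f^A is the transformation law of a connection: twice the c/(2(ct+d)) term is what
differentiating an automorphy factor leaves behind. So f' + 2f² is covariant of weight 4, g ↦ g' +
4mfg raises weight 2m to 2m + 2, and repeated differentiation gives covariants `cov₂`, `cov₃`,
`cov₄` of weights 4, 6, 8. Associativity of the product of the potential follows from Chazy's
equation f''' + 24ff'' - 36f'² = 0, whose left side is the covariant `cov₄ f - 48 (cov₂ f)²` of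
weight 8.

For 2πi f^∞, which is fixed by SL(2, ℤ), these covariants are level one modular forms. As there are
no cusp forms of weight below 12, limits at i∞ identify them: `cov₂` and `cov₃` are nonzero
multiples of E₄ and E₆, and the Chazy expression is zero. Covariance carries Chazy's equation to
every f^{(τ,ω)}, so all the manifolds are Frobenius.

The matrix A^{(τ,ω)} sends 0 to τ with denominator ω there, so the germ of f^{(τ,ω)} at 0 determines
E₄(τ)/ω⁴ and E₆(τ)/ω⁶, hence g₂ and g₃ of the lattice ω(ℤ + ℤτ). By the Weierstrass equation these
determine ℘, whose poles are the lattice; so equal germs give ω₁ = (cτ₀ + d)ω₀ for some element of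
SL(2, ℤ) (`exists_sl_of_fFun_eventuallyEq`). Conversely γA^{(τ,ω)} is A at (γτ, (cτ + d)ω), so
f^{(τ,ω)} depends only on the lattice. The exponent k absorbs the stabilizer: every k-th root of
unity is an automorphy factor of an element fixing τ₀ (`mem_stabFactors_of_pow_eq_one`).

An isomorphism preserves dt = η(e, ·), so it translates t. Metric, Euler field and product then
force f₀(t) = f₁(t + b), and since both discs are centred at 0, b = 0 (`eqOn_of_isomorphic_ball`).
-/

/-! ### Covariant differentiation for the action of `GL₂(ℂ)` -/

/-- The covariant derivative, with respect to the connection `f`, of a form `g` of weight `2m`. -/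
def covDeriv (m : ℕ) (f g : ℂ → ℂ) (z : ℂ) : ℂ := deriv g z + 4 * m * f z * g z

/-- The curvature-like expression `f' + 2 f²`, which transforms with weight `4`. -/
def cov₂ (f : ℂ → ℂ) (z : ℂ) : ℂ := deriv f z + 2 * f z ^ 2

/-- The covariant derivative of `cov₂ f`, which transforms with weight `6`. -/
def cov₃ (f : ℂ → ℂ) : ℂ → ℂ := covDeriv 2 f (cov₂ f)

/-- The covariant derivative of `cov₃ f`, which transforms with weight `8`. -/
def cov₄ (f : ℂ → ℂ) : ℂ → ℂ := covDeriv 3 f (cov₃ f)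

/-- The Chazy expression; see `chazy_eq`. -/
def chazy (f : ℂ → ℂ) (z : ℂ) : ℂ := cov₄ f z - 48 * cov₂ f z ^ 2

/-- The Möbius transformation of a matrix. -/
def moebius (A : Matrix (Fin 2) (Fin 2) ℂ) (t : ℂ) : ℂ :=
  (A 0 0 * t + A 0 1) / (A 1 0 * t + A 1 1)

theorem hasDerivAt_linear (a b t : ℂ) : HasDerivAt (fun s => a * s + b) a t := by
  simpa using ((hasDerivAt_id t).const_mul a).add_const b

theorem hasDerivAt_moebius {A : Matrix (Fin 2) (Fin 2) ℂ} {t : ℂ} (ht : A 1 0 * t + A 1 1 ≠ 0) :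
    HasDerivAt (moebius A) (A.det / (A 1 0 * t + A 1 1) ^ 2) t := by
  refine ((hasDerivAt_linear (A 0 0) (A 0 1) t).div (hasDerivAt_linear (A 1 0) (A 1 1) t)
    ht).congr_deriv ?_
  rw [Matrix.det_fin_two]
  congr 1
  ring

theorem hasDerivAt_glAct {A : Matrix (Fin 2) (Fin 2) ℂ} {f : ℂ → ℂ} {t : ℂ}
    (ht : A 1 0 * t + A 1 1 ≠ 0) (hf : DifferentiableAt ℂ f (moebius A t)) :
    HasDerivAt (glAct A f)
      (A.det ^ 2 / (A 1 0 * t + A 1 1) ^ 4 * deriv f (moebius A t)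
        - 2 * A 1 0 * A.det / (A 1 0 * t + A 1 1) ^ 3 * f (moebius A t)
        - A 1 0 ^ 2 / (2 * (A 1 0 * t + A 1 1) ^ 2)) t := by
  have hJ := hasDerivAt_linear (A 1 0) (A 1 1) t
  have h1 := (hasDerivAt_const t A.det).div (hJ.pow 2) (pow_ne_zero 2 ht)
  have h2 := hf.hasDerivAt.comp t (hasDerivAt_moebius ht)
  have h3 := (hasDerivAt_const t (A 1 0)).div (hJ.const_mul 2) (mul_ne_zero two_ne_zero ht)
  refine ((h1.mul h2).add h3).congr_deriv ?_
  simp only [Function.comp_apply, Pi.div_apply, Pi.pow_apply]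
  field_simp
  ring

theorem cov₂_glAct {A : Matrix (Fin 2) (Fin 2) ℂ} {f : ℂ → ℂ} {t : ℂ}
    (ht : A 1 0 * t + A 1 1 ≠ 0) (hf : DifferentiableAt ℂ f (moebius A t)) :
    cov₂ (glAct A f) t = A.det ^ 2 / (A 1 0 * t + A 1 1) ^ (2 * 2) * cov₂ f (moebius A t) := by
  rw [cov₂, (hasDerivAt_glAct ht hf).deriv, cov₂, glAct, ← moebius]
  field_simp
  ring

/-- Differentiating the factor (ct+d)^(-2m) produces -2mc/(ct+d) times h, and the inhomogeneous term
of `glAct`, multiplied by 4m, cancels it. -/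
theorem covDeriv_glAct {A : Matrix (Fin 2) (Fin 2) ℂ} {f g h : ℂ → ℂ} {m : ℕ} {t : ℂ}
    (ht : A 1 0 * t + A 1 1 ≠ 0) (hg : DifferentiableAt ℂ g (moebius A t))
    (hh : ∀ᶠ s in 𝓝 t, h s = A.det ^ m / (A 1 0 * s + A 1 1) ^ (2 * m) * g (moebius A s)) :
    covDeriv m (glAct A f) h t
      = A.det ^ (m + 1) / (A 1 0 * t + A 1 1) ^ (2 * (m + 1)) * covDeriv m f g (moebius A t) := by
  have hJ := hasDerivAt_linear (A 1 0) (A 1 1) t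
  have h1 := (hasDerivAt_const t (A.det ^ m)).div (hJ.pow (2 * m)) (pow_ne_zero _ ht)
  have h2 := hg.hasDerivAt.comp t (hasDerivAt_moebius ht)
  have h3 : HasDerivAt h _ t := (h1.mul h2).congr_of_eventuallyEq hh
  rw [covDeriv, h3.deriv, hh.self_of_nhds, covDeriv, glAct, ← moebius]
  simp only [Function.comp_apply, Pi.div_apply, Pi.pow_apply]
  -- The derivative of (ct+d)^(2m) carries the truncated exponent 2m - 1, so m = 0 is treated apart.
  rcases m with _ | m
  · simp
    field_simp
  · rw [show 2 * (m + 1) - 1 = 2 * m + 1 by omega]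
    field_simp
    push_cast
    ring

theorem differentiableOn_covDeriv {U : Set ℂ} (hU : IsOpen U) {f g : ℂ → ℂ} {m : ℕ}
    (hf : DifferentiableOn ℂ f U) (hg : DifferentiableOn ℂ g U) :
    DifferentiableOn ℂ (covDeriv m f g) U :=
  (hg.deriv hU).add ((hf.const_mul _).mul hg)

theorem differentiableOn_cov₂ {U : Set ℂ} (hU : IsOpen U) {f : ℂ → ℂ}
    (hf : DifferentiableOn ℂ f U) : DifferentiableOn ℂ (cov₂ f) U :=
  (hf.deriv hU).add ((hf.pow 2).const_mul 2)

theorem differentiableOn_cov₃ {U : Set ℂ} (hU : IsOpen U) {f : ℂ → ℂ}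
    (hf : DifferentiableOn ℂ f U) : DifferentiableOn ℂ (cov₃ f) U :=
  differentiableOn_covDeriv hU hf (differentiableOn_cov₂ hU hf)

theorem differentiableOn_cov₄ {U : Set ℂ} (hU : IsOpen U) {f : ℂ → ℂ}
    (hf : DifferentiableOn ℂ f U) : DifferentiableOn ℂ (cov₄ f) U :=
  differentiableOn_covDeriv hU hf (differentiableOn_cov₃ hU hf)

theorem differentiableOn_chazy {U : Set ℂ} (hU : IsOpen U) {f : ℂ → ℂ}
    (hf : DifferentiableOn ℂ f U) : DifferentiableOn ℂ (chazy f) U :=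
  (differentiableOn_cov₄ hU hf).sub (((differentiableOn_cov₂ hU hf).pow 2).const_mul 48)

/-- The Chazy expression in terms of the derivatives of `f`. -/
theorem chazy_eq {U : Set ℂ} (hU : IsOpen U) {f : ℂ → ℂ} (hf : DifferentiableOn ℂ f U) {z : ℂ}
    (hz : z ∈ U) :
    chazy f z = deriv (deriv (deriv f)) z + 24 * f z * deriv (deriv f) z - 36 * deriv f z ^ 2 := by
  have hd0 : ∀ w ∈ U, HasDerivAt f (deriv f w) w := fun w hw =>
    (hf.differentiableAt (hU.mem_nhds hw)).hasDerivAt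
  have hd1 : ∀ w ∈ U, HasDerivAt (deriv f) (deriv (deriv f) w) w := fun w hw =>
    ((hf.deriv hU).differentiableAt (hU.mem_nhds hw)).hasDerivAt
  have hd2 : HasDerivAt (deriv (deriv f)) (deriv (deriv (deriv f)) z) z :=
    (((hf.deriv hU).deriv hU).differentiableAt (hU.mem_nhds hz)).hasDerivAt
  have h3 : ∀ w ∈ U, cov₃ f w = deriv (deriv f) w + 12 * (f w * deriv f w) + 16 * f w ^ 3 := by
    intro w hw
    have : HasDerivAt (cov₂ f) _ w := (hd1 w hw).add (((hd0 w hw).pow 2).const_mul 2)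
    rw [cov₃, covDeriv, this.deriv, cov₂]
    push_cast
    ring
  have h4 : HasDerivAt (cov₃ f) _ z :=
    ((hd2.add (((hd0 z hz).mul (hd1 z hz)).const_mul 12)).add
      (((hd0 z hz).pow 3).const_mul 16)).congr_of_eventuallyEq
      (Filter.eventually_of_mem (hU.mem_nhds hz) h3)
  -- The coefficient 48 is the one for which the terms f²f' and f⁴ cancel.
  rw [chazy, cov₄, covDeriv, h4.deriv, h3 z hz, cov₂]
  push_cast
  ring

section Covariance

variable {A : Matrix (Fin 2) (Fin 2) ℂ} {f : ℂ → ℂ} {U V : Set ℂ}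

theorem differentiableOn_glAct (hA : ∀ t ∈ V, A 1 0 * t + A 1 1 ≠ 0)
    (hAV : Set.MapsTo (moebius A) V U) (hU : IsOpen U) (hf : DifferentiableOn ℂ f U) :
    DifferentiableOn ℂ (glAct A f) V := fun t ht =>
  (hasDerivAt_glAct (hA t ht) (hf.differentiableAt
    (hU.mem_nhds (hAV ht)))).differentiableAt.differentiableWithinAt

theorem cov₂_glAct_of_mapsTo (hA : ∀ t ∈ V, A 1 0 * t + A 1 1 ≠ 0)
    (hAV : Set.MapsTo (moebius A) V U) (hU : IsOpen U) (hf : DifferentiableOn ℂ f U) {t : ℂ}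
    (ht : t ∈ V) :
    cov₂ (glAct A f) t = A.det ^ 2 / (A 1 0 * t + A 1 1) ^ (2 * 2) * cov₂ f (moebius A t) :=
  cov₂_glAct (hA t ht) (hf.differentiableAt (hU.mem_nhds (hAV ht)))

theorem cov₃_glAct_of_mapsTo (hA : ∀ t ∈ V, A 1 0 * t + A 1 1 ≠ 0)
    (hAV : Set.MapsTo (moebius A) V U) (hU : IsOpen U) (hV : IsOpen V)
    (hf : DifferentiableOn ℂ f U) {t : ℂ} (ht : t ∈ V) :
    cov₃ (glAct A f) t = A.det ^ 3 / (A 1 0 * t + A 1 1) ^ (2 * 3) * cov₃ f (moebius A t) :=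
  covDeriv_glAct (hA t ht)
    ((differentiableOn_cov₂ hU hf).differentiableAt (hU.mem_nhds (hAV ht)))
    (eventually_of_mem (hV.mem_nhds ht) fun _ hs => cov₂_glAct_of_mapsTo hA hAV hU hf hs)

theorem cov₄_glAct_of_mapsTo (hA : ∀ t ∈ V, A 1 0 * t + A 1 1 ≠ 0)
    (hAV : Set.MapsTo (moebius A) V U) (hU : IsOpen U) (hV : IsOpen V)
    (hf : DifferentiableOn ℂ f U) {t : ℂ} (ht : t ∈ V) :
    cov₄ (glAct A f) t = A.det ^ 4 / (A 1 0 * t + A 1 1) ^ (2 * 4) * cov₄ f (moebius A t) :=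
  covDeriv_glAct (hA t ht)
    ((differentiableOn_cov₃ hU hf).differentiableAt (hU.mem_nhds (hAV ht)))
    (eventually_of_mem (hV.mem_nhds ht) fun _ hs => cov₃_glAct_of_mapsTo hA hAV hU hV hf hs)

theorem chazy_glAct_of_mapsTo (hA : ∀ t ∈ V, A 1 0 * t + A 1 1 ≠ 0)
    (hAV : Set.MapsTo (moebius A) V U) (hU : IsOpen U) (hV : IsOpen V)
    (hf : DifferentiableOn ℂ f U) {t : ℂ} (ht : t ∈ V) :
    chazy (glAct A f) t = A.det ^ 4 / (A 1 0 * t + A 1 1) ^ (2 * 4) * chazy f (moebius A t) := by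
  rw [chazy, cov₄_glAct_of_mapsTo hA hAV hU hV hf ht, cov₂_glAct_of_mapsTo hA hAV hU hf ht, chazy]
  have := hA t ht
  field_simp
  ring

end Covariance

/-! ### The covariants depend only on the germ. -/

theorem cov₂_congr {f g : ℂ → ℂ} {z : ℂ} (h : f =ᶠ[𝓝 z] g) : cov₂ f =ᶠ[𝓝 z] cov₂ g := by
  filter_upwards [h, h.deriv] with w h1 h2
  rw [cov₂, cov₂, h1, h2]

theorem covDeriv_congr {f g f' g' : ℂ → ℂ} {z : ℂ} {m : ℕ} (h : f =ᶠ[𝓝 z] g)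
    (h' : f' =ᶠ[𝓝 z] g') : covDeriv m f f' =ᶠ[𝓝 z] covDeriv m g g' := by
  filter_upwards [h, h', h'.deriv] with w h1 h2 h3
  rw [covDeriv, covDeriv, h1, h2, h3]

theorem cov₃_congr {f g : ℂ → ℂ} {z : ℂ} (h : f =ᶠ[𝓝 z] g) : cov₃ f =ᶠ[𝓝 z] cov₃ g :=
  covDeriv_congr h (cov₂_congr h)

theorem cov₄_congr {f g : ℂ → ℂ} {z : ℂ} (h : f =ᶠ[𝓝 z] g) : cov₄ f =ᶠ[𝓝 z] cov₄ g :=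
  covDeriv_congr h (cov₃_congr h)

theorem chazy_congr {f g : ℂ → ℂ} {z : ℂ} (h : f =ᶠ[𝓝 z] g) : chazy f =ᶠ[𝓝 z] chazy g := by
  filter_upwards [cov₂_congr h, cov₄_congr h] with w h1 h2
  rw [chazy, chazy, h1, h2]

/-! ### Modular forms of level one -/

theorem isOpen_upperHalfPlane : IsOpen {z : ℂ | 0 < z.im} :=
  isOpen_lt continuous_const Complex.continuous_im

/-- A level one form of weight less than twelve that vanishes at infinity is zero. -/
theorem eq_zero_of_isZeroAtImInfty {k : ℤ} (hk : k < 12) {g : ℍ → ℂ}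
    (hg : ∀ γ : SL(2, ℤ), SlashAction.map k γ g = g)
    (hd : DifferentiableOn ℂ (g ∘ ofComplex) {z | 0 < z.im}) (h0 : Tendsto g atImInfty (𝓝 0)) :
    g = 0 := by
  let G : CuspForm (Matrix.SpecialLinearGroup.mapGL (n := Fin 2) (R := ℤ) ℝ).range k :=
    { toFun := g
      slash_action_eq' := by
        rintro _ ⟨γ, rfl⟩
        exact hg γ
      holo' := UpperHalfPlane.mdifferentiable_iff.mpr hd
      zero_at_cusps' := by
        -- Every cusp is an SL(2, ℤ)-translate of i∞, so slash invariance reduces vanishing there to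
        -- vanishing at i∞.
        intro c hc
        rw [Subgroup.IsArithmetic.isCusp_iff_isCusp_SL2Z] at hc
        rw [OnePoint.isZeroAt_iff_forall_SL2Z hc]
        intro γ _
        rw [show SlashAction.map k γ g = g from hg γ]
        exact h0 }
  have := rank_zero_iff_forall_zero.mp (CuspForm.rank_eq_zero_of_weight_lt_twelve hk) G
  exact congrArg (fun f : CuspForm _ k => (f : ℍ → ℂ)) this

/-- The limit at i∞ is the value at q = 0 of the cusp function. The formulation through q-series
serves E₂, which is not a modular form. -/
theorem tendsto_atImInfty_of_hasSum {f : ℍ → ℂ} {c : ℕ → ℂ}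
    (hd : DifferentiableOn ℂ (f ∘ ofComplex) {z | 0 < z.im})
    (hp : Function.Periodic (f ∘ ofComplex) (1 : ℝ))
    (hf : ∀ τ : ℍ, HasSum (fun m => c m • Function.Periodic.qParam 1 (τ : ℂ) ^ m) (f τ)) :
    Tendsto f atImInfty (𝓝 (c 0)) := by
  have hb := isBoundedAtImInfty_of_hasSum_qExpansion one_pos hf
  have ha := analyticAt_cuspFunction_zero one_pos hp (UpperHalfPlane.mdifferentiable_iff.mpr hd) hb
  have h0 : cuspFunction 1 f 0 = c 0 := by
    have := (hasFPowerSeriesOnBall_cuspFunction one_pos ha hf).hasFPowerSeriesAt.coeff_zero ![]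
    simpa using this.symm
  have := ha.continuousAt.tendsto.comp (qParam_tendsto_atImInfty one_pos)
  rw [h0] at this
  exact this.congr fun τ => eq_cuspFunction τ one_ne_zero hp

theorem tendsto_E_atImInfty {k : ℕ} (hk : 3 ≤ k) (hk2 : Even k) :
    Tendsto (ModularForm.E hk) atImInfty (𝓝 1) := by
  have ha := ModularFormClass.analyticAt_cuspFunction_zero (ModularForm.E hk) one_pos
    one_mem_strictPeriods_SL
  have hp := SlashInvariantFormClass.periodic_comp_ofComplex (ModularForm.E hk)
    one_mem_strictPeriods_SL
  have h0 : cuspFunction 1 (ModularForm.E hk) 0 = 1 := by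
    rw [cuspFunction_apply_zero one_pos ha hp, ← qExpansion_coeff_zero one_pos ha hp]
    exact EisensteinSeries.E_qExpansion_coeff_zero hk hk2
  have := ha.continuousAt.tendsto.comp (qParam_tendsto_atImInfty one_pos)
  rw [h0] at this
  exact this.congr fun τ => eq_cuspFunction τ one_ne_zero hp

theorem differentiableOn_E2 :
    DifferentiableOn ℂ (EisensteinSeries.E2 ∘ ofComplex) {z | 0 < z.im} :=
  UpperHalfPlane.mdifferentiable_iff.mp E2_mdifferentiable

theorem tendsto_E2_atImInfty : Tendsto EisensteinSeries.E2 atImInfty (𝓝 1) := by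
  have hp : Function.Periodic (EisensteinSeries.E2 ∘ ofComplex) (1 : ℝ) := by
    intro z
    by_cases hz : 0 < z.im
    · have hz' : 0 < (z + (1 : ℝ)).im := by simpa using hz
      simp only [Function.comp_apply, ofComplex_apply_of_im_pos hz, ofComplex_apply_of_im_pos hz',
        EisensteinSeries.E2_eq_tsum_cexp]
      simp [mul_add, Complex.exp_add]
    -- Outside the half plane `ofComplex` takes a constant default value, so periodicity holds there
    -- too.
    · have hz' : ¬ 0 < (z + (1 : ℝ)).im := by simpa using hz
      simp only [Function.comp_apply, ofComplex_apply_of_im_nonpos (not_lt.mp hz),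
        ofComplex_apply_of_im_nonpos (not_lt.mp hz')]
  have := tendsto_atImInfty_of_hasSum (c := fun m : ℕ =>
    if m = 0 then 1 else -24 * (ArithmeticFunction.sigma 1 m : ℂ)) differentiableOn_E2 hp fun τ => by
      simpa only [Function.Periodic.qParam, Complex.ofReal_one, div_one] using
        EisensteinSeries.hasSum_qExpansion_E2 (z := τ)
  simpa using this

/-- Cauchy's estimate: the derivative of a function with a limit at `i∞` tends to zero. -/
theorem tendsto_deriv_atImInfty {g : ℂ → ℂ} {L : ℂ} (hd : DifferentiableOn ℂ g {z | 0 < z.im})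
    (hg : Tendsto (fun τ : ℍ => g τ) atImInfty (𝓝 L)) :
    Tendsto (fun τ : ℍ => deriv g τ) atImInfty (𝓝 0) := by
  rw [Metric.tendsto_nhds] at hg ⊢
  intro ε hε
  obtain ⟨B, hB⟩ := (atImInfty_mem _).mp (hg (ε / 2) (half_pos hε))
  refine (atImInfty_mem _).mpr ⟨max B 1 + 1, fun τ hτ => ?_⟩
  have hball : ∀ w ∈ Metric.closedBall (τ : ℂ) 1, max B 1 ≤ w.im := by
    intro w hw
    have h1 := (Complex.abs_im_le_norm (w - τ)).trans (mem_closedBall_iff_norm.mp hw)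
    rw [Complex.sub_im, coe_im] at h1
    linarith [(abs_le.mp h1).1]
  have hpos : ∀ w ∈ Metric.closedBall (τ : ℂ) 1, 0 < w.im := fun w hw =>
    zero_lt_one.trans_le ((le_max_right B 1).trans (hball w hw))
  have hdc : DiffContOnCl ℂ (fun z => g z - L) (Metric.ball (τ : ℂ) 1) := by
    refine DifferentiableOn.diffContOnCl ?_
    rw [closure_ball _ one_ne_zero]
    exact (hd.mono hpos).sub_const L
  have := Complex.norm_deriv_le_of_forall_mem_sphere_norm_le one_pos hdc (C := ε / 2) fun w hw => by
    have hw' := Metric.sphere_subset_closedBall hw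
    have : dist (g w) L < ε / 2 :=
      hB ⟨w, hpos w hw'⟩ ((le_max_left B 1).trans (hball w hw'))
    exact (dist_eq_norm (g w) L).symm.le.trans this.le
  rw [deriv_sub_const] at this
  show dist (deriv g τ) 0 < ε
  rw [dist_zero_right]
  linarith

/-! ### The function `2πi f^∞` -/

/-- The function `2πi f^∞`, a multiple of `E₂`. -/
def eisF (z : ℂ) : ℂ := 2 * Real.pi * Complex.I * fInfty z

/-- The value of `eisF` at `i∞`. -/
def eisConst : ℂ := -(Real.pi * Complex.I / 12)

theorem eisF_coe (τ : ℍ) : eisF τ = eisConst * EisensteinSeries.E2 τ := by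
  rw [eisF, fInfty, ofComplex_apply, eisConst]
  ring

theorem eisConst_ne_zero : eisConst ≠ 0 := by
  simp [eisConst, Real.pi_ne_zero]

theorem differentiableOn_eisF : DifferentiableOn ℂ eisF {z | 0 < z.im} :=
  (differentiableOn_E2.const_mul (2 * Real.pi * Complex.I * -(1 / 24))).congr fun z _ => by
    simp only [eisF, fInfty, Function.comp_apply]
    ring

theorem tendsto_eisF : Tendsto (fun τ : ℍ => eisF τ) atImInfty (𝓝 eisConst) := by
  simpa [eisF_coe] using tendsto_E2_atImInfty.const_mul eisConst

/-- The complex matrix of an element of `SL(2, ℤ)`. -/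
def slMat (γ : SL(2, ℤ)) : Matrix (Fin 2) (Fin 2) ℂ := (γ : Matrix (Fin 2) (Fin 2) ℤ).map (↑)

theorem slMat_apply (γ : SL(2, ℤ)) (i j : Fin 2) : slMat γ i j = ((γ i j : ℤ) : ℂ) := rfl

theorem det_slMat (γ : SL(2, ℤ)) : (slMat γ).det = 1 := by
  have := γ.det_coe
  rw [Matrix.det_fin_two] at this ⊢
  simp only [slMat_apply]
  exact_mod_cast this

theorem slMat_denom (γ : SL(2, ℤ)) (τ : ℍ) :
    slMat γ 1 0 * τ + slMat γ 1 1 = denom γ τ := by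
  simp [slMat_apply, ModularGroup.denom_apply]

theorem slMat_denom_ne_zero (γ : SL(2, ℤ)) (τ : ℍ) :
    slMat γ 1 0 * τ + slMat γ 1 1 ≠ 0 := by
  rw [slMat_denom]
  exact denom_ne_zero _ _

theorem moebius_slMat (γ : SL(2, ℤ)) (τ : ℍ) : moebius (slMat γ) τ = (γ • τ : ℍ) := by
  rw [moebius, UpperHalfPlane.specialLinearGroup_apply]
  simp [slMat_apply]

/-- The quasi-modular anomaly of E₂, scaled by `eisConst`, is exactly the inhomogeneous term
c/(2(cτ+d)) of the action; this fixes the normalisation 2πi f^∞. -/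
theorem glAct_slMat_eisF (γ : SL(2, ℤ)) (τ : ℍ) : glAct (slMat γ) eisF τ = eisF τ := by
  have h := congrFun (EisensteinSeries.E2_slash_action γ) τ
  rw [ModularForm.SL_slash_apply] at h
  simp only [Pi.sub_apply, Pi.smul_apply, smul_eq_mul, EisensteinSeries.D2, riemannZeta_two] at h
  have hd := slMat_denom_ne_zero γ τ
  rw [glAct, ← moebius, moebius_slMat, det_slMat, eisF_coe, eisF_coe, slMat_denom]
  rw [slMat_denom] at hd
  have hE : EisensteinSeries.E2 (γ • τ) = denom γ τ ^ 2 * (EisensteinSeries.E2 τ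
      - 1 / (2 * ((Real.pi : ℂ) ^ 2 / 6)) * (2 * Real.pi * Complex.I * (γ 1 0 : ℤ) / denom γ τ)) := by
    rw [← h, zpow_neg]
    field_simp
  have hpi : (Real.pi : ℂ) ≠ 0 := by exact_mod_cast Real.pi_ne_zero
  rw [hE, slMat_apply, eisConst]
  field_simp
  linear_combination (12 * ((γ 1 0 : ℤ) : ℂ)) * Complex.I_sq

theorem mapsTo_moebius_slMat (γ : SL(2, ℤ)) :
    Set.MapsTo (moebius (slMat γ)) {z | 0 < z.im} {z | 0 < z.im} := fun z hz => by
  have := moebius_slMat γ ⟨z, hz⟩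
  change moebius (slMat γ) z = _ at this
  rw [Set.mem_ofPred_eq, this]
  exact (γ • (⟨z, hz⟩ : ℍ)).im_pos

theorem slMat_denom_ne_zero' (γ : SL(2, ℤ)) :
    ∀ z ∈ {z : ℂ | 0 < z.im}, slMat γ 1 0 * z + slMat γ 1 1 ≠ 0 := fun z hz =>
  slMat_denom_ne_zero γ ⟨z, hz⟩

theorem glAct_slMat_eisF_eventuallyEq (γ : SL(2, ℤ)) (τ : ℍ) :
    glAct (slMat γ) eisF =ᶠ[𝓝 (τ : ℂ)] eisF :=
  eventually_of_mem (isOpen_upperHalfPlane.mem_nhds τ.im_pos) fun z hz => glAct_slMat_eisF γ ⟨z, hz⟩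

/-! ### Modularity of the covariants of `eisF` and their limits at i∞. -/

theorem slash_eq_of_moebius {m : ℕ} {g : ℂ → ℂ}
    (hg : ∀ (γ : SL(2, ℤ)) (τ : ℍ), g τ = (slMat γ).det ^ m /
      (slMat γ 1 0 * τ + slMat γ 1 1) ^ (2 * m) * g (moebius (slMat γ) τ)) (γ : SL(2, ℤ)) :
    SlashAction.map ((2 * m : ℕ) : ℤ) γ (fun τ : ℍ => g τ) = fun τ : ℍ => g τ := by
  funext τ
  rw [ModularForm.SL_slash_apply, hg γ τ, det_slMat, moebius_slMat, slMat_denom, zpow_neg,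
    zpow_natCast]
  ring

theorem slash_cov₂_eisF (γ : SL(2, ℤ)) :
    SlashAction.map ((2 * 2 : ℕ) : ℤ) γ (fun τ : ℍ => cov₂ eisF τ) = fun τ : ℍ => cov₂ eisF τ :=
  slash_eq_of_moebius (fun γ τ => by
    rw [← (cov₂_congr (glAct_slMat_eisF_eventuallyEq γ τ)).self_of_nhds]
    exact cov₂_glAct_of_mapsTo (slMat_denom_ne_zero' γ) (mapsTo_moebius_slMat γ)
      isOpen_upperHalfPlane differentiableOn_eisF τ.im_pos) γ

theorem slash_cov₃_eisF (γ : SL(2, ℤ)) :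
    SlashAction.map ((2 * 3 : ℕ) : ℤ) γ (fun τ : ℍ => cov₃ eisF τ) = fun τ : ℍ => cov₃ eisF τ :=
  slash_eq_of_moebius (fun γ τ => by
    rw [← (cov₃_congr (glAct_slMat_eisF_eventuallyEq γ τ)).self_of_nhds]
    exact cov₃_glAct_of_mapsTo (slMat_denom_ne_zero' γ) (mapsTo_moebius_slMat γ)
      isOpen_upperHalfPlane isOpen_upperHalfPlane differentiableOn_eisF τ.im_pos) γ

theorem slash_chazy_eisF (γ : SL(2, ℤ)) :
    SlashAction.map ((2 * 4 : ℕ) : ℤ) γ (fun τ : ℍ => chazy eisF τ) = fun τ : ℍ => chazy eisF τ :=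
  slash_eq_of_moebius (fun γ τ => by
    rw [← (chazy_congr (glAct_slMat_eisF_eventuallyEq γ τ)).self_of_nhds]
    exact chazy_glAct_of_mapsTo (slMat_denom_ne_zero' γ) (mapsTo_moebius_slMat γ)
      isOpen_upperHalfPlane isOpen_upperHalfPlane differentiableOn_eisF τ.im_pos) γ

theorem tendsto_covDeriv {g : ℂ → ℂ} {L : ℂ} (m : ℕ) (hd : DifferentiableOn ℂ g {z | 0 < z.im})
    (hg : Tendsto (fun τ : ℍ => g τ) atImInfty (𝓝 L)) :
    Tendsto (fun τ : ℍ => covDeriv m eisF g τ) atImInfty (𝓝 (4 * m * eisConst * L)) := by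
  simpa [covDeriv] using
    (tendsto_deriv_atImInfty hd hg).add ((tendsto_eisF.const_mul (4 * m : ℂ)).mul hg)

theorem tendsto_cov₂_eisF :
    Tendsto (fun τ : ℍ => cov₂ eisF τ) atImInfty (𝓝 (2 * eisConst ^ 2)) := by
  simpa [cov₂] using (tendsto_deriv_atImInfty differentiableOn_eisF tendsto_eisF).add
    ((tendsto_eisF.pow 2).const_mul 2)

theorem tendsto_cov₃_eisF :
    Tendsto (fun τ : ℍ => cov₃ eisF τ) atImInfty (𝓝 (16 * eisConst ^ 3)) := by
  convert tendsto_covDeriv 2 (differentiableOn_cov₂ isOpen_upperHalfPlane differentiableOn_eisF)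
    tendsto_cov₂_eisF using 2
  · rfl
  · push_cast
    ring

theorem tendsto_cov₄_eisF :
    Tendsto (fun τ : ℍ => cov₄ eisF τ) atImInfty (𝓝 (192 * eisConst ^ 4)) := by
  convert tendsto_covDeriv 3 (differentiableOn_cov₃ isOpen_upperHalfPlane differentiableOn_eisF)
    tendsto_cov₃_eisF using 2
  · rfl
  · push_cast
    ring

theorem tendsto_chazy_eisF : Tendsto (fun τ : ℍ => chazy eisF τ) atImInfty (𝓝 0) := by
  have := tendsto_cov₄_eisF.sub ((tendsto_cov₂_eisF.pow 2).const_mul 48)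
  -- Since 192 = 48 · 2², the Chazy expression has no constant term and so is a cusp form.
  rwa [show 192 * eisConst ^ 4 - 48 * (2 * eisConst ^ 2) ^ 2 = 0 by ring] at this

theorem differentiableOn_comp_ofComplex {g : ℂ → ℂ} (hg : DifferentiableOn ℂ g {z | 0 < z.im}) :
    DifferentiableOn ℂ ((fun τ : ℍ => g τ) ∘ ofComplex) {z | 0 < z.im} :=
  hg.congr fun z hz => by simp [ofComplex_apply_of_im_pos hz]

/-- The difference g - L·E_k is a cusp form of weight below 12, because E_k tends to 1. -/
theorem eq_smul_E {k : ℕ} (hk : 3 ≤ k) (hk2 : Even k) (hk' : k < 12) {g : ℂ → ℂ} {L : ℂ}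
    (hg : ∀ γ : SL(2, ℤ), SlashAction.map (k : ℤ) γ (fun τ : ℍ => g τ) = fun τ : ℍ => g τ)
    (hd : DifferentiableOn ℂ g {z | 0 < z.im})
    (hL : Tendsto (fun τ : ℍ => g τ) atImInfty (𝓝 L)) (τ : ℍ) :
    g τ = L * ModularForm.E hk τ := by
  have hE : ∀ γ : SL(2, ℤ), SlashAction.map (k : ℤ) γ (ModularForm.E hk : ℍ → ℂ)
      = ModularForm.E hk := fun γ => (ModularForm.E hk).slash_action_eq' _ ⟨γ, rfl⟩
  have := eq_zero_of_isZeroAtImInfty (k := k) (by exact_mod_cast hk')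
    (g := (fun τ : ℍ => g τ) - L • (ModularForm.E hk : ℍ → ℂ))
    (fun γ => by
      rw [sub_eq_add_neg, SlashAction.add_slash, SlashAction.neg_slash,
        ModularForm.SL_smul_slash, hg, hE])
    ((differentiableOn_comp_ofComplex hd).sub
      ((UpperHalfPlane.mdifferentiable_iff.mp (ModularForm.E hk).holo').const_smul L))
    (by
      have := hL.sub ((tendsto_E_atImInfty hk hk2).const_mul L)
      rwa [mul_one, sub_self] at this)
  simpa [sub_eq_zero] using congrFun this τ

theorem cov₂_eisF (τ : ℍ) : cov₂ eisF τ = 2 * eisConst ^ 2 * ModularForm.E₄ τ :=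
  eq_smul_E (by norm_num) ⟨2, rfl⟩ (by norm_num) slash_cov₂_eisF
    (differentiableOn_cov₂ isOpen_upperHalfPlane differentiableOn_eisF) tendsto_cov₂_eisF τ

theorem cov₃_eisF (τ : ℍ) : cov₃ eisF τ = 16 * eisConst ^ 3 * ModularForm.E₆ τ :=
  eq_smul_E (by norm_num) ⟨3, rfl⟩ (by norm_num) slash_cov₃_eisF
    (differentiableOn_cov₃ isOpen_upperHalfPlane differentiableOn_eisF) tendsto_cov₃_eisF τ

/-- The Chazy equation for `2πi f^∞`. -/
theorem chazy_eisF (τ : ℍ) : chazy eisF τ = 0 :=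
  congrFun (eq_zero_of_isZeroAtImInfty (by norm_num) slash_chazy_eisF
    (differentiableOn_comp_ofComplex
      (differentiableOn_chazy isOpen_upperHalfPlane differentiableOn_eisF)) tendsto_chazy_eisF) τ

/-! ### A lattice is determined by its invariants -/

/-- A solution of `z d' α = d β` near `0` vanishes if `β 0 / α 0` is not a natural number. -/
theorem eventually_eq_zero_of_fuchsian {d d' α β : ℂ → ℂ} (hd : AnalyticAt ℂ d 0)
    (hd' : ∀ᶠ z in 𝓝 0, deriv d z = d' z) (hα : ContinuousAt α 0) (hβ : ContinuousAt β 0)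
    (h : ∀ᶠ z in 𝓝[≠] 0, z * d' z * α z = d z * β z) (hn : ∀ n : ℕ, n * α 0 ≠ β 0) :
    ∀ᶠ z in 𝓝 0, d z = 0 := by
  by_contra hne
  obtain ⟨n, g, hg, hg0, hdg⟩ := hd.exists_eventuallyEq_pow_smul_nonzero_iff.mpr hne
  simp only [sub_zero, smul_eq_mul] at hdg
  have hdiff : ∀ᶠ z in 𝓝 (0 : ℂ), DifferentiableAt ℂ g z :=
    hg.eventually_analyticAt.mono fun z hz => hz.differentiableAt
  have hderiv : ∀ᶠ z in 𝓝 (0 : ℂ), z * d' z = z ^ n * (n * g z + z * deriv g z) := by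
    have hdg' : d =ᶠ[𝓝 0] fun z => z ^ n * g z := hdg
    filter_upwards [hdg'.deriv, hdiff, hd'] with z h1 h2 h3
    have h4 : HasDerivAt (fun z => z ^ n * g z) _ z := (hasDerivAt_pow n z).mul h2.hasDerivAt
    rw [← h3, h1, h4.deriv]
    rcases n with _ | n
    · simp
    · rw [Nat.add_sub_cancel]
      ring
  -- With d = zⁿg and g(0) ≠ 0, divide the equation by zⁿ; letting z → 0 leaves n α(0) = β(0), the
  -- excluded case.
  have key : ∀ᶠ z in 𝓝[≠] (0 : ℂ), (n * g z + z * deriv g z) * α z = g z * β z := by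
    filter_upwards [h, hderiv.filter_mono nhdsWithin_le_nhds,
      hdg.filter_mono nhdsWithin_le_nhds, self_mem_nhdsWithin] with z h1 h2 h3 h4
    rw [h2, h3] at h1
    refine mul_left_cancel₀ (pow_ne_zero n h4) ?_
    linear_combination h1
  have hl : ContinuousAt (fun z => (n * g z + z * deriv g z) * α z) 0 :=
    ((continuousAt_const.mul hg.continuousAt).add
      (continuousAt_id.mul hg.deriv.continuousAt)).mul hα
  have hr : ContinuousAt (fun z => g z * β z) 0 := hg.continuousAt.mul hβ
  have := tendsto_nhds_unique_of_eventuallyEq (hl.tendsto.mono_left nhdsWithin_le_nhds)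
    (hr.tendsto.mono_left nhdsWithin_le_nhds) key
  refine hn n (mul_left_cancel₀ hg0 ?_)
  simp only [zero_mul, add_zero] at this
  linear_combination this

/-! ### Uniqueness for the Weierstrass equation. -/

theorem eventually_notMem_lattice (L : PeriodPair) (l : ℂ) : ∀ᶠ z in 𝓝[≠] l, z ∉ L.lattice := by
  filter_upwards [mem_nhdsWithin_of_mem_nhds (L.compl_lattice_sdiff_singleton_mem_nhds l),
    self_mem_nhdsWithin] with z h1 h2 h3
  exact h1 ⟨h3, h2⟩

theorem sq_mul_weierstrassP (L : PeriodPair) {z : ℂ} (hz : z ≠ 0) :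
    z ^ 2 * L.weierstrassP z = z ^ 2 * L.weierstrassPExcept 0 z + 1 := by
  have := L.weierstrassPExcept_add 0 z
  simp only [ZeroMemClass.coe_zero, sub_zero] at this
  rw [← this]
  field_simp
  simp

theorem cube_mul_derivWeierstrassP (L : PeriodPair) {z : ℂ} (hz : z ≠ 0) :
    z ^ 3 * L.derivWeierstrassP z = z ^ 3 * L.derivWeierstrassPExcept 0 z - 2 := by
  have := L.derivWeierstrassPExcept_sub 0 z
  simp only [ZeroMemClass.coe_zero, sub_zero] at this
  rw [← this]
  field_simp

/-- Subtracting the two Weierstrass equations and factoring the differences of squares and cubes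
gives a linear equation for the difference d of the regular parts. Multiplied by z⁴ it reads z d' α
= d β with α(0) = -4 and β(0) = 12, so the only possible order of vanishing is -3, and d = 0. -/
theorem weierstrassPExcept_eventuallyEq {L L' : PeriodPair} (h₂ : L.g₂ = L'.g₂)
    (h₃ : L.g₃ = L'.g₃) : ∀ᶠ z in 𝓝 (0 : ℂ), L.weierstrassPExcept 0 z - L'.weierstrassPExcept 0 z = 0 := by
  have hc : ∀ L : PeriodPair, ContinuousAt (L.weierstrassPExcept 0) 0 := fun L =>
    (L.analyticAt_weierstrassPExcept 0).continuousAt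
  have hc' : ∀ L : PeriodPair, ContinuousAt (L.derivWeierstrassPExcept 0) 0 := fun L =>
    (L.analyticAt_derivWeierstrassPExcept 0).continuousAt
  have hdiff : ∀ L : PeriodPair, ∀ᶠ z in 𝓝 (0 : ℂ),
      HasDerivAt (L.weierstrassPExcept 0) (L.derivWeierstrassPExcept 0 z) z := fun L => by
    filter_upwards [L.compl_lattice_sdiff_singleton_mem_nhds 0] with z hz
    rw [← L.eqOn_deriv_weierstrassPExcept_derivWeierstrassPExcept 0 hz]
    exact ((L.differentiableOn_weierstrassPExcept 0).differentiableAt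
      (L.isOpen_compl_lattice_sdiff.mem_nhds hz)).hasDerivAt
  refine eventually_eq_zero_of_fuchsian
    (d' := fun z => L.derivWeierstrassPExcept 0 z - L'.derivWeierstrassPExcept 0 z)
    (α := fun z => z ^ 3 * L.derivWeierstrassPExcept 0 z - 2
      + (z ^ 3 * L'.derivWeierstrassPExcept 0 z - 2))
    (β := fun z => 4 * ((z ^ 2 * L.weierstrassPExcept 0 z + 1) ^ 2
      + (z ^ 2 * L.weierstrassPExcept 0 z + 1) * (z ^ 2 * L'.weierstrassPExcept 0 z + 1)
      + (z ^ 2 * L'.weierstrassPExcept 0 z + 1) ^ 2) - L.g₂ * z ^ 4)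
    ((L.analyticAt_weierstrassPExcept 0).sub (L'.analyticAt_weierstrassPExcept 0)) ?_ ?_ ?_ ?_ ?_
  · filter_upwards [hdiff L, hdiff L'] with z h1 h2
    exact (h1.sub h2).deriv
  · have := hc' L
    have := hc' L'
    fun_prop
  · have := hc L
    have := hc L'
    fun_prop
  · filter_upwards [eventually_notMem_lattice L 0, eventually_notMem_lattice L' 0,
      self_mem_nhdsWithin] with z h1 h2 hz
    have e1 := L.derivWeierstrassP_sq z h1
    have e2 := L'.derivWeierstrassP_sq z h2
    rw [← h₂, ← h₃] at e2
    have hz' : z ≠ 0 := hz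
    have d1 : z ^ 3 * (L.derivWeierstrassPExcept 0 z - L'.derivWeierstrassPExcept 0 z)
        = z ^ 3 * (L.derivWeierstrassP z - L'.derivWeierstrassP z) := by
      rw [mul_sub, mul_sub, cube_mul_derivWeierstrassP L hz', cube_mul_derivWeierstrassP L' hz']
      ring
    have d2 : z ^ 2 * (L.weierstrassPExcept 0 z - L'.weierstrassPExcept 0 z)
        = z ^ 2 * (L.weierstrassP z - L'.weierstrassP z) := by
      rw [mul_sub, mul_sub, sq_mul_weierstrassP L hz', sq_mul_weierstrassP L' hz']
      ring
    have d1' := mul_left_cancel₀ (pow_ne_zero 3 hz') d1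
    have d2' := mul_left_cancel₀ (pow_ne_zero 2 hz') d2
    simp only [d1', d2', ← cube_mul_derivWeierstrassP L hz', ← cube_mul_derivWeierstrassP L' hz',
      ← sq_mul_weierstrassP L hz', ← sq_mul_weierstrassP L' hz']
    linear_combination z ^ 4 * (e1 - e2)
  · intro n hn
    have : ((n : ℂ) + 3) = 0 := by
      simp only [ne_eq, OfNat.ofNat_ne_zero, not_false_eq_true, zero_pow, zero_mul, zero_add] at hn
      linear_combination -hn / 4
    exact absurd this (by exact_mod_cast (Nat.succ_ne_zero (n + 2)))

theorem countable_lattice (L : PeriodPair) : (L.lattice : Set ℂ).Countable := by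
  have : (L.lattice : Set ℂ) = Set.range fun p : ℤ × ℤ => (p.1 * L.ω₁ + p.2 * L.ω₂ : ℂ) := by
    ext z
    simp [PeriodPair.mem_lattice]
  rw [this]
  exact Set.countable_range _

/-- The local equality near 0 spreads by the identity theorem, the complement of a countable set in
the plane being connected. -/
theorem weierstrassP_eqOn {L L' : PeriodPair} (h₂ : L.g₂ = L'.g₂) (h₃ : L.g₃ = L'.g₃) :
    Set.EqOn L.weierstrassP L'.weierstrassP ((L.lattice : Set ℂ) ∪ L'.lattice)ᶜ := by
  have hconn : IsPreconnected ((L.lattice : Set ℂ) ∪ L'.lattice)ᶜ :=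
    (((countable_lattice L).union (countable_lattice L')).isPathConnected_compl_of_one_lt_rank
      (by rw [Complex.rank_real_complex]; norm_num)).isConnected.isPreconnected
  have hp : ∀ᶠ z in 𝓝[≠] (0 : ℂ), L.weierstrassP z = L'.weierstrassP z := by
    filter_upwards [(weierstrassPExcept_eventuallyEq h₂ h₃).filter_mono nhdsWithin_le_nhds,
      self_mem_nhdsWithin] with z h1 hz
    have hz' : z ≠ 0 := hz
    refine mul_left_cancel₀ (pow_ne_zero 2 hz') ?_
    rw [sq_mul_weierstrassP L hz', sq_mul_weierstrassP L' hz', sub_eq_zero.mp h1]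
  obtain ⟨z, hz, h1, h2⟩ := ((eventually_nhdsNE_eventually_nhds_iff.mpr hp).and
    ((eventually_notMem_lattice L 0).and (eventually_notMem_lattice L' 0))).exists
  exact (L.analyticOnNhd_weierstrassP.mono
    (Set.compl_subset_compl.mpr Set.subset_union_left)).eqOn_of_preconnected_of_eventuallyEq
    (L'.analyticOnNhd_weierstrassP.mono (Set.compl_subset_compl.mpr Set.subset_union_right))
    hconn (z₀ := z) (by simp [h1, h2]) hz

/-- A point of one lattice outside the other would be a pole of one ℘ and a regular point of the
other, though the two agree near it. -/
theorem lattice_le_of_invariants_eq {L L' : PeriodPair} (h₂ : L.g₂ = L'.g₂) (h₃ : L.g₃ = L'.g₃) :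
    L.lattice ≤ L'.lattice := by
  intro l hl
  by_contra hl'
  have heq : L.weierstrassP =ᶠ[𝓝[≠] l] L'.weierstrassP := by
    filter_upwards [eventually_notMem_lattice L l, eventually_notMem_lattice L' l] with z h1 h2
    exact weierstrassP_eqOn h₂ h₃ (by simp [h1, h2])
  have h := L.order_weierstrassP l hl
  rw [meromorphicOrderAt_congr heq] at h
  have := (L'.analyticOnNhd_weierstrassP l hl').meromorphicOrderAt_nonneg
  rw [h] at this
  exact absurd this (by decide)

/-! ### The lattices ω(ℤ + ℤτ) and their Eisenstein sums. -/

/-- The period pair `(ω, ωτ)`. -/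
def periodPair (τ : ℍ) (ω : ℂ) (hω : ω ≠ 0) : PeriodPair where
  ω₁ := ω
  ω₂ := ω * τ
  indep := by
    rw [LinearIndependent.pair_iff]
    intro s t h
    have h' : (s + t * τ : ℂ) = 0 := by
      refine mul_left_cancel₀ hω ?_
      rw [mul_zero, ← h, Complex.real_smul, Complex.real_smul]
      ring
    have ht : t = 0 := by
      have := congrArg Complex.im h'
      simpa [τ.im_ne_zero] using this
    subst ht
    exact ⟨by simpa using h', rfl⟩

theorem G_periodPair {k : ℕ} (hk : 3 ≤ k) (τ : ℍ) {ω : ℂ} (hω : ω ≠ 0) :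
    (periodPair τ ω hω).G k = (ω ^ k)⁻¹ * (2 * riemannZeta k * ModularForm.E hk τ) := by
  have hE : ModularForm.E hk τ = 1 / 2 * eisensteinSeries (N := 1) 0 k τ := rfl
  rw [hE, PeriodPair.G, ← (periodPair τ ω hω).latticeEquivProd.symm.toEquiv.tsum_eq]
  have := tsum_eisSummand_eq_riemannZeta_mul_eisensteinSeries hk τ
  -- The coordinates are swapped: in `eisSummand` the first one multiplies τ, in the period pair the
  -- second.
  rw [← (((finTwoArrowEquiv ℤ).trans (Equiv.prodComm ℤ ℤ)).symm.tsum_eq)] at this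
  rw [show (2 * riemannZeta k * (1 / 2 * eisensteinSeries (N := 1) 0 k τ) : ℂ)
    = riemannZeta k * eisensteinSeries (N := 1) 0 k τ by ring, ← this, ← tsum_mul_left]
  refine tsum_congr fun p => ?_
  have hp : ((periodPair τ ω hω).latticeEquivProd.symm p : ℂ) = ω * (p.2 * τ + p.1) := by
    rw [PeriodPair.latticeEquiv_symm_apply]
    simp only [periodPair]
    ring
  simp [EisensteinSeries.eisSummand, hp, mul_pow, mul_comm]

/-- Two lattices `ω (ℤ + ℤτ)` that agree are related by an element of `SL(2, ℤ)`. -/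
theorem exists_sl_of_lattice_eq {τ₀ τ₁ : ℍ} {ω₀ ω₁ : ℂ} (hω₀ : ω₀ ≠ 0) (hω₁ : ω₁ ≠ 0)
    (h : (periodPair τ₀ ω₀ hω₀).lattice = (periodPair τ₁ ω₁ hω₁).lattice) :
    ∃ γ : SL(2, ℤ), τ₁ = γ • τ₀ ∧ ω₁ = denom γ τ₀ * ω₀ := by
  have key : ∀ {τ₀ τ₁ : ℍ} {ω₀ ω₁ : ℂ} (hω₀ : ω₀ ≠ 0) (hω₁ : ω₁ ≠ 0),
      (periodPair τ₀ ω₀ hω₀).lattice = (periodPair τ₁ ω₁ hω₁).lattice →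
      ∃ a b c d : ℤ, ω₁ * τ₁ = ω₀ * (a * τ₀ + b) ∧ ω₁ = ω₀ * (c * τ₀ + d) := by
    intro τ₀ τ₁ ω₀ ω₁ hω₀ hω₁ h
    have h1 := (periodPair τ₁ ω₁ hω₁).ω₁_mem_lattice
    have h2 := (periodPair τ₁ ω₁ hω₁).ω₂_mem_lattice
    rw [← h, PeriodPair.mem_lattice] at h1 h2
    obtain ⟨d, c, h1⟩ := h1
    obtain ⟨b, a, h2⟩ := h2
    simp only [periodPair] at h1 h2
    exact ⟨a, b, c, d, by linear_combination -h2, by linear_combination -h1⟩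
  obtain ⟨a, b, c, d, e1, e2⟩ := key hω₀ hω₁ h
  obtain ⟨a', b', c', d', e3, e4⟩ := key hω₁ hω₀ h.symm
  have indep : ∀ m n : ℤ, (m * τ₀ + n : ℂ) = 0 → m = 0 ∧ n = 0 := by
    intro m n hmn
    have hm : m = 0 := by
      have := congrArg Complex.im hmn
      simpa [τ₀.im_ne_zero] using this
    subst hm
    exact ⟨rfl, by simpa using hmn⟩
  -- The two integral base changes are mutually inverse, so the determinant is ±1.
  obtain ⟨i1, i2⟩ := indep (a' * a + b' * c - 1) (a' * b + b' * d) (by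
    refine mul_left_cancel₀ hω₀ ?_
    push_cast
    linear_combination -e3 - a' * e1 - b' * e2)
  obtain ⟨i3, i4⟩ := indep (c' * a + d' * c) (c' * b + d' * d - 1) (by
    refine mul_left_cancel₀ hω₀ ?_
    push_cast
    linear_combination -e4 - c' * e1 - d' * e2)
  have hunit : (a * d - b * c) * (a' * d' - b' * c') = 1 := by
    linear_combination (c' * b + d' * d) * i1 - (c' * a + d' * c) * i2 + i4
  have hden : (c * τ₀ + d : ℂ) ≠ 0 := fun h0 => hω₁ (by rw [e2, h0, mul_zero])
  have hτ : (τ₁ : ℂ) = (a * τ₀ + b) / (c * τ₀ + d) := by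
    rw [eq_div_iff hden]
    refine mul_left_cancel₀ hω₀ ?_
    linear_combination e1 - τ₁ * e2
  -- Both points lie in the upper half plane, which makes the determinant positive and excludes -1.
  have him : τ₁.im * Complex.normSq (c * τ₀ + d) = ((a * d - b * c : ℤ) : ℝ) * τ₀.im := by
    have : (τ₁ : ℂ) * Complex.normSq (c * τ₀ + d)
        = (a * τ₀ + b) * (starRingEnd ℂ) (c * τ₀ + d) := by
      rw [hτ, ← Complex.mul_conj, ← mul_assoc, div_mul_cancel₀ _ hden]
    have := congrArg Complex.im this
    rw [Complex.im_mul_ofReal, coe_im] at this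
    rw [this]
    simp
    ring
  have hpos : 0 < a * d - b * c := by
    have h1 : 0 < τ₁.im * Complex.normSq (c * τ₀ + d) :=
      mul_pos τ₁.im_pos (Complex.normSq_pos.mpr hden)
    rw [him] at h1
    exact_mod_cast pos_of_mul_pos_left h1 τ₀.im_pos.le
  have hdet : a * d - b * c = 1 := by
    rcases Int.eq_one_or_neg_one_of_mul_eq_one hunit with h1 | h1 <;> omega
  obtain ⟨γ, hγ⟩ : ∃ γ : SL(2, ℤ), (γ : Matrix (Fin 2) (Fin 2) ℤ) = !![a, b; c, d] :=
    ⟨⟨!![a, b; c, d], by rw [Matrix.det_fin_two_of, hdet]⟩, rfl⟩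
  refine ⟨γ, ?_, ?_⟩
  · ext1
    rw [UpperHalfPlane.specialLinearGroup_apply, hτ]
    simp [hγ]
  · rw [ModularGroup.denom_apply, e2, mul_comm]
    simp [hγ]

/-! ### The functions `f^{(τ,ω)}` -/

theorem fFun_eq_glAct (τ : ℍ) (ω : ℂ) : fFun τ ω = glAct (matA τ ω) eisF := rfl

theorem disc_eq_ball (τ : ℍ) (ω : ℂ) :
    disc τ ω = Metric.ball 0 (4 * Real.pi * ‖ω‖ ^ 2 * τ.im) := by
  ext t
  simp [disc, abs_of_pos Real.pi_pos, abs_of_pos τ.im_pos]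

theorem isOpen_disc (τ : ℍ) (ω : ℂ) : IsOpen (disc τ ω) := by
  rw [disc_eq_ball]
  exact Metric.isOpen_ball

theorem disc_radius_pos (τ : ℍ) {ω : ℂ} (hω : ω ≠ 0) : 0 < 4 * Real.pi * ‖ω‖ ^ 2 * τ.im :=
  mul_pos (mul_pos (mul_pos four_pos Real.pi_pos) (pow_pos (norm_pos_iff.mpr hω) 2)) τ.im_pos

theorem zero_mem_disc (τ : ℍ) {ω : ℂ} (hω : ω ≠ 0) : (0 : ℂ) ∈ disc τ ω := by
  rw [disc_eq_ball]
  exact Metric.mem_ball_self (disc_radius_pos τ hω)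

theorem matA_coeff_norm_lt {τ : ℍ} {ω t : ℂ} (hω : ω ≠ 0) (ht : t ∈ disc τ ω) :
    ‖1 / (4 * Real.pi * ω * τ.im) * t‖ < ‖ω‖ := by
  rw [disc_eq_ball, mem_ball_zero_iff] at ht
  have hpos : 0 < 4 * Real.pi * ‖ω‖ * τ.im :=
    mul_pos (mul_pos (mul_pos four_pos Real.pi_pos) (norm_pos_iff.mpr hω)) τ.im_pos
  have hn : ‖1 / (4 * Real.pi * ω * τ.im) * t‖ = ‖t‖ / (4 * Real.pi * ‖ω‖ * τ.im) := by
    simp [abs_of_pos Real.pi_pos, abs_of_pos τ.im_pos, div_eq_inv_mul]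
  rw [hn, div_lt_iff₀ hpos]
  linarith

theorem add_ne_zero_of_norm_lt {s ω : ℂ} (h : ‖s‖ < ‖ω‖) : s + ω ≠ 0 := fun h0 => by
  rw [eq_neg_of_add_eq_zero_left h0, norm_neg] at h
  exact lt_irrefl _ h

/-- This is a Cayley transform: its imaginary part times |s + ω|² equals Im τ (|ω|² - |s|²). With s
= t/(4πω Im τ) it is the Möbius map of `matA`, and |s| < |ω| is the condition defining the disc. -/
theorem im_pos_of_norm_lt (τ : ℍ) {s ω : ℂ} (h : ‖s‖ < ‖ω‖) :
    0 < (((starRingEnd ℂ) (τ : ℂ) * s + ω * τ) / (s + ω)).im := by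
  have hJ := add_ne_zero_of_norm_lt h
  have h1 : ((starRingEnd ℂ) (τ : ℂ) * s + ω * τ) / (s + ω) * Complex.normSq (s + ω)
      = ((starRingEnd ℂ) (τ : ℂ) * s + ω * τ) * (starRingEnd ℂ) (s + ω) := by
    rw [← Complex.mul_conj, ← mul_assoc, div_mul_cancel₀ _ hJ]
  have h2 := congrArg Complex.im h1
  rw [Complex.im_mul_ofReal] at h2
  have h3 : (((starRingEnd ℂ) (τ : ℂ) * s + ω * τ) * (starRingEnd ℂ) (s + ω)).im
      = τ.im * (Complex.normSq ω - Complex.normSq s) := by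
    simp [Complex.normSq_apply]
    ring
  have h4 : Complex.normSq s < Complex.normSq ω := by
    rw [Complex.normSq_eq_norm_sq, Complex.normSq_eq_norm_sq]
    exact pow_lt_pow_left₀ h (norm_nonneg _) two_ne_zero
  refine pos_of_mul_pos_left (b := Complex.normSq (s + ω)) ?_ (Complex.normSq_nonneg _)
  rw [h2, h3]
  exact mul_pos τ.im_pos (sub_pos.mpr h4)

theorem matA_denom_ne_zero {τ : ℍ} {ω : ℂ} (hω : ω ≠ 0) :
    ∀ t ∈ disc τ ω, matA τ ω 1 0 * t + matA τ ω 1 1 ≠ 0 := fun t ht => by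
  simpa [matA] using add_ne_zero_of_norm_lt (matA_coeff_norm_lt hω ht)

theorem mapsTo_moebius_matA {τ : ℍ} {ω : ℂ} (hω : ω ≠ 0) :
    Set.MapsTo (moebius (matA τ ω)) (disc τ ω) {z | 0 < z.im} := fun t ht => by
  have := im_pos_of_norm_lt τ (matA_coeff_norm_lt hω ht)
  have he : moebius (matA τ ω) t = ((starRingEnd ℂ) (τ : ℂ) * (1 / (4 * Real.pi * ω * τ.im) * t)
      + ω * τ) / (1 / (4 * Real.pi * ω * τ.im) * t + ω) := by
    simp only [moebius, matA, Matrix.of_apply, Matrix.cons_val', Matrix.cons_val_zero,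
      Matrix.cons_val_one, Matrix.cons_val_fin_one]
    ring
  rwa [Set.mem_ofPred_eq, he]

theorem det_matA (τ : ℍ) {ω : ℂ} (hω : ω ≠ 0) :
    (matA τ ω).det = 1 / (2 * Real.pi * Complex.I) := by
  have hpi : (Real.pi : ℂ) ≠ 0 := by exact_mod_cast Real.pi_ne_zero
  have hy : (τ.im : ℂ) ≠ 0 := by exact_mod_cast τ.im_ne_zero
  have hc : (τ : ℂ) - (starRingEnd ℂ) (τ : ℂ) = 2 * τ.im * Complex.I := by
    rw [Complex.sub_conj, coe_im]
    push_cast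
    ring
  rw [matA, Matrix.det_fin_two_of]
  field_simp
  linear_combination (-2 * Complex.I) * hc - 4 * τ.im * Complex.I_sq

theorem differentiableOn_fFun (τ : ℍ) {ω : ℂ} (hω : ω ≠ 0) :
    DifferentiableOn ℂ (fFun τ ω) (disc τ ω) :=
  differentiableOn_glAct (matA_denom_ne_zero hω) (mapsTo_moebius_matA hω) isOpen_upperHalfPlane
    differentiableOn_eisF

theorem chazy_fFun (τ : ℍ) {ω : ℂ} (hω : ω ≠ 0) {t : ℂ} (ht : t ∈ disc τ ω) :
    chazy (fFun τ ω) t = 0 := by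
  rw [fFun_eq_glAct, chazy_glAct_of_mapsTo (matA_denom_ne_zero hω) (mapsTo_moebius_matA hω)
    isOpen_upperHalfPlane (isOpen_disc τ ω) differentiableOn_eisF ht,
    show chazy eisF (moebius (matA τ ω) t) = 0 from
      chazy_eisF ⟨_, mapsTo_moebius_matA hω ht⟩, mul_zero]

theorem moebius_matA_zero (τ : ℍ) {ω : ℂ} (hω : ω ≠ 0) : moebius (matA τ ω) 0 = τ := by
  simp [moebius, matA, hω]

theorem cov₂_fFun_zero (τ : ℍ) {ω : ℂ} (hω : ω ≠ 0) :
    cov₂ (fFun τ ω) 0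
      = (1 / (2 * Real.pi * Complex.I)) ^ 2 / ω ^ 4 * (2 * eisConst ^ 2 * ModularForm.E₄ τ) := by
  rw [fFun_eq_glAct, cov₂_glAct_of_mapsTo (matA_denom_ne_zero hω) (mapsTo_moebius_matA hω)
    isOpen_upperHalfPlane differentiableOn_eisF (zero_mem_disc τ hω), moebius_matA_zero τ hω,
    cov₂_eisF, det_matA τ hω]
  simp [matA]

theorem cov₃_fFun_zero (τ : ℍ) {ω : ℂ} (hω : ω ≠ 0) :
    cov₃ (fFun τ ω) 0
      = (1 / (2 * Real.pi * Complex.I)) ^ 3 / ω ^ 6 * (16 * eisConst ^ 3 * ModularForm.E₆ τ) := by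
  rw [fFun_eq_glAct, cov₃_glAct_of_mapsTo (matA_denom_ne_zero hω) (mapsTo_moebius_matA hω)
    isOpen_upperHalfPlane (isOpen_disc τ ω) differentiableOn_eisF (zero_mem_disc τ hω),
    moebius_matA_zero τ hω, cov₃_eisF, det_matA τ hω]
  simp [matA]

/-- The germ of `f^{(τ,ω)}` at zero determines `(τ, ω)` up to `SL(2, ℤ)`. -/
theorem exists_sl_of_fFun_eventuallyEq {τ₀ τ₁ : ℍ} {ω₀ ω₁ : ℂ} (hω₀ : ω₀ ≠ 0) (hω₁ : ω₁ ≠ 0)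
    (h : fFun τ₀ ω₀ =ᶠ[𝓝 0] fFun τ₁ ω₁) :
    ∃ γ : SL(2, ℤ), τ₁ = γ • τ₀ ∧ ω₁ = denom γ τ₀ * ω₀ := by
  have h₂ := (cov₂_congr h).self_of_nhds
  have h₃ := (cov₃_congr h).self_of_nhds
  rw [cov₂_fFun_zero τ₀ hω₀, cov₂_fFun_zero τ₁ hω₁] at h₂
  rw [cov₃_fFun_zero τ₀ hω₀, cov₃_fFun_zero τ₁ hω₁] at h₃
  have hpi : (1 / (2 * Real.pi * Complex.I) : ℂ) ≠ 0 := by simp [Real.pi_ne_zero]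
  have hE : eisConst ≠ 0 := eisConst_ne_zero
  have e₂ : (ω₀ ^ 4)⁻¹ * ModularForm.E₄ τ₀ = (ω₁ ^ 4)⁻¹ * ModularForm.E₄ τ₁ := by
    refine mul_left_cancel₀ (mul_ne_zero (mul_ne_zero two_ne_zero (pow_ne_zero 2 hpi))
      (pow_ne_zero 2 hE)) ?_
    linear_combination h₂
  have e₃ : (ω₀ ^ 6)⁻¹ * ModularForm.E₆ τ₀ = (ω₁ ^ 6)⁻¹ * ModularForm.E₆ τ₁ := by
    refine mul_left_cancel₀ (mul_ne_zero (mul_ne_zero (by norm_num : (16 : ℂ) ≠ 0)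
      (pow_ne_zero 3 hpi)) (pow_ne_zero 3 hE)) ?_
    linear_combination h₃
  have g₂ : (periodPair τ₀ ω₀ hω₀).g₂ = (periodPair τ₁ ω₁ hω₁).g₂ := by
    rw [PeriodPair.g₂, PeriodPair.g₂, G_periodPair (by norm_num) _ hω₀,
      G_periodPair (by norm_num) _ hω₁]
    linear_combination (60 * 2 * riemannZeta (4 : ℕ)) * e₂
  have g₃ : (periodPair τ₀ ω₀ hω₀).g₃ = (periodPair τ₁ ω₁ hω₁).g₃ := by
    rw [PeriodPair.g₃, PeriodPair.g₃, G_periodPair (by norm_num) _ hω₀,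
      G_periodPair (by norm_num) _ hω₁]
    linear_combination (140 * 2 * riemannZeta (6 : ℕ)) * e₃
  exact exists_sl_of_lattice_eq hω₀ hω₁
    (le_antisymm (lattice_le_of_invariants_eq g₂ g₃) (lattice_le_of_invariants_eq g₂.symm g₃.symm))

/-! ### Invariance under `SL(2, ℤ)` -/

/-- The order is reversed because this is a right action; `hc` is the cocycle identity for the
inhomogeneous term. -/
theorem glAct_mul {A B : Matrix (Fin 2) (Fin 2) ℂ} (f : ℂ → ℂ) {t : ℂ}
    (hB : B 1 0 * t + B 1 1 ≠ 0) (hA : A 1 0 * moebius B t + A 1 1 ≠ 0) :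
    glAct (A * B) f t = glAct B (glAct A f) t := by
  have hJ : (A * B) 1 0 * t + (A * B) 1 1
      = (B 1 0 * t + B 1 1) * (A 1 0 * moebius B t + A 1 1) := by
    simp only [Matrix.mul_apply, Fin.sum_univ_two, moebius]
    field_simp
    ring
  have hN : (A * B) 0 0 * t + (A * B) 0 1
      = (B 1 0 * t + B 1 1) * (A 0 0 * moebius B t + A 0 1) := by
    simp only [Matrix.mul_apply, Fin.sum_univ_two, moebius]
    field_simp
    ring
  have hm : moebius B t * (B 1 0 * t + B 1 1) = B 0 0 * t + B 0 1 := div_mul_cancel₀ _ hB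
  have hc : (A * B) 1 0 * (B 1 0 * t + B 1 1)
      = A 1 0 * B.det + B 1 0 * (B 1 0 * t + B 1 1) * (A 1 0 * moebius B t + A 1 1) := by
    simp only [Matrix.mul_apply, Fin.sum_univ_two, Matrix.det_fin_two]
    linear_combination (-A 1 0 * B 1 0) * hm
  rw [glAct, hN, hJ, mul_div_mul_left _ _ hB, Matrix.det_mul, glAct, ← moebius, glAct, ← moebius,
    ← moebius]
  generalize f (moebius A (moebius B t)) = w
  generalize moebius B t = z at *
  generalize (A * B) 1 0 = c at *
  field_simp
  linear_combination (A 1 0 * z + A 1 1) * hc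

/-- The columns are multiples of (τ̄, 1) and (τ, 1), which γ maps to multiples of their counterparts
for γτ by the factors j̄ and j. The scalars match because Im γτ = Im τ/(j j̄). -/
theorem slMat_mul_matA (γ : SL(2, ℤ)) (τ : ℍ) {ω : ℂ} (hω : ω ≠ 0) :
    slMat γ * matA τ ω = matA (γ • τ) (denom γ τ * ω) := by
  have hj := slMat_denom_ne_zero γ τ
  have hpi : (Real.pi : ℂ) ≠ 0 := by exact_mod_cast Real.pi_ne_zero
  have hy : (τ.im : ℂ) ≠ 0 := by exact_mod_cast τ.im_ne_zero
  have hj' : slMat γ 1 0 * (starRingEnd ℂ) (τ : ℂ) + slMat γ 1 1 ≠ 0 := by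
    have := (map_ne_zero (starRingEnd ℂ)).mpr hj
    simpa [slMat_apply] using this
  have hτ : ((γ • τ : ℍ) : ℂ)
      = (slMat γ 0 0 * τ + slMat γ 0 1) / (slMat γ 1 0 * τ + slMat γ 1 1) :=
    (moebius_slMat γ τ).symm
  have hτ' : (starRingEnd ℂ) ((γ • τ : ℍ) : ℂ) = (slMat γ 0 0 * (starRingEnd ℂ) (τ : ℂ)
      + slMat γ 0 1) / (slMat γ 1 0 * (starRingEnd ℂ) (τ : ℂ) + slMat γ 1 1) := by
    rw [hτ]
    simp [slMat_apply]
  have him : ((γ • τ : ℍ).im : ℂ) = τ.im / ((slMat γ 1 0 * τ + slMat γ 1 1)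
      * (slMat γ 1 0 * (starRingEnd ℂ) (τ : ℂ) + slMat γ 1 1)) := by
    rw [ModularGroup.im_smul_eq_div_normSq, ← slMat_denom, Complex.ofReal_div, ← Complex.mul_conj]
    simp [slMat_apply]
  rw [← slMat_denom]
  generalize hj0 : slMat γ 1 0 * (τ : ℂ) + slMat γ 1 1 = j at *
  generalize hj1 : slMat γ 1 0 * (starRingEnd ℂ) (τ : ℂ) + slMat γ 1 1 = j' at *
  ext i k
  fin_cases i <;> fin_cases k <;>
    simp only [Matrix.mul_apply, Fin.sum_univ_two, matA, hτ', him, Fin.zero_eta, Fin.mk_one,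
      Matrix.of_apply, Matrix.cons_val', Matrix.cons_val_zero, Matrix.cons_val_one,
      Matrix.cons_val_fin_one]
  · field_simp
  · rw [hτ]
    field_simp
  · field_simp
    linear_combination hj1
  · linear_combination ω * hj0

/-- The radius is 4π times |ω|² Im τ, the covolume of ω(ℤ + ℤτ). -/
theorem disc_smul (γ : SL(2, ℤ)) (τ : ℍ) (ω : ℂ) :
    disc (γ • τ) (denom γ τ * ω) = disc τ ω := by
  have hd : ‖denom γ τ‖ ≠ 0 := norm_ne_zero_iff.mpr (denom_ne_zero γ τ)
  have him : (γ • τ).im = τ.im / ‖denom γ τ‖ ^ 2 := by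
    rw [ModularGroup.im_smul_eq_div_normSq, Complex.normSq_eq_norm_sq]
  rw [disc_eq_ball, disc_eq_ball, norm_mul, him]
  congr 1
  field_simp

theorem eqOn_fFun_smul (γ : SL(2, ℤ)) (τ : ℍ) {ω : ℂ} (hω : ω ≠ 0) :
    Set.EqOn (fFun τ ω) (fFun (γ • τ) (denom γ τ * ω)) (disc τ ω) := by
  intro t ht
  have hz := mapsTo_moebius_matA hω ht
  rw [fFun_eq_glAct, fFun_eq_glAct, ← slMat_mul_matA γ τ hω,
    glAct_mul _ (matA_denom_ne_zero hω t ht) (slMat_denom_ne_zero' γ _ hz), glAct, ← moebius,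
    glAct, ← moebius]
  rw [show glAct (slMat γ) eisF (moebius (matA τ ω) t) = eisF (moebius (matA τ ω) t) from
    glAct_slMat_eisF γ ⟨_, hz⟩]

/-! ### Stabilizers and roots of unity -/

theorem denom_mul (γ δ : SL(2, ℤ)) (τ : ℍ) :
    denom ((γ * δ : SL(2, ℤ))) τ = denom γ (δ • τ : ℍ) * denom δ τ := by
  have h := slMat_denom_ne_zero δ τ
  rw [← slMat_denom γ, ← slMat_denom δ, ← slMat_denom (γ * δ), ← moebius_slMat, moebius,
    add_mul, mul_assoc, div_mul_cancel₀ _ h]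
  simp [slMat_apply, Matrix.mul_apply, Fin.sum_univ_two]
  ring

/-- The values at `τ` of the automorphy factors of the stabilizer of `τ`. -/
def stabFactors (τ : ℍ) : Set ℂ := {ζ | ∃ δ : SL(2, ℤ), δ • τ = τ ∧ denom δ τ = ζ}

theorem pow_mem_stabFactors {τ : ℍ} {ζ : ℂ} (h : ζ ∈ stabFactors τ) (n : ℕ) :
    ζ ^ n ∈ stabFactors τ := by
  obtain ⟨δ, h1, h2⟩ := h
  induction n with
  | zero => exact ⟨1, one_smul _ _, by simp⟩
  | succ n ih =>
    obtain ⟨ε, h3, h4⟩ := ih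
    exact ⟨ε * δ, by rw [mul_smul, h1, h3], by rw [denom_mul, h1, h2, h4, pow_succ]⟩

/-- Conjugation by σ carries stabilizer to stabilizer, and the cocycle rule cancels the factors of σ
and σ⁻¹. It reduces the orbits of i and ρ to i and ρ themselves. -/
theorem stabFactors_smul {τ : ℍ} {ζ : ℂ} (h : ζ ∈ stabFactors τ) (σ : SL(2, ℤ)) :
    ζ ∈ stabFactors (σ • τ) := by
  obtain ⟨δ, h1, h2⟩ := h
  refine ⟨σ * δ * σ⁻¹, by simp [mul_smul, h1], ?_⟩
  have h3 : denom ((σ⁻¹ * σ : SL(2, ℤ))) τ = 1 := by simp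
  rw [denom_mul] at h3
  rw [denom_mul, denom_mul, inv_smul_smul, h1, h2]
  linear_combination ζ * h3

theorem neg_one_mem_stabFactors (τ : ℍ) : -1 ∈ stabFactors τ :=
  ⟨-1, by simp, by rw [ModularGroup.denom_apply]; simp⟩

theorem I_mem_stabFactors : Complex.I ∈ stabFactors UpperHalfPlane.I := by
  refine ⟨ModularGroup.S, ?_, ?_⟩
  · ext1
    rw [UpperHalfPlane.specialLinearGroup_apply]
    simp [ModularGroup.S]
  · rw [ModularGroup.denom_apply]
    simp [ModularGroup.S]

theorem isPrimitiveRoot_rho : IsPrimitiveRoot (rho : ℂ) 3 := by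
  have := Complex.isPrimitiveRoot_exp 3 (by norm_num)
  rwa [Nat.cast_ofNat] at this

theorem rho_sq_add_rho_add_one : (rho : ℂ) ^ 2 + rho + 1 = 0 := by
  have := isPrimitiveRoot_rho.geom_sum_eq_zero (by norm_num)
  simp only [Finset.sum_range_succ, Finset.sum_range_zero, pow_zero, pow_one] at this
  linear_combination this

theorem isPrimitiveRoot_rho_add_one : IsPrimitiveRoot (rho + 1 : ℂ) 6 := by
  have h := rho_sq_add_rho_add_one
  have h2 : (rho + 1 : ℂ) ^ 2 = rho := by linear_combination h
  have h3 : (rho + 1 : ℂ) ^ 3 = -1 := by linear_combination (rho + 2 : ℂ) * h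
  have him : (rho : ℂ).im ≠ 0 := rho.im_ne_zero
  have h6 : (rho + 1 : ℂ) ^ 6 = 1 := by linear_combination ((rho + 1 : ℂ) ^ 3 - 1) * h3
  refine IsPrimitiveRoot.mk_of_lt _ (by norm_num) h6 fun l hl hl' hone => ?_
  have h4 : (rho + 1 : ℂ) ^ 4 = -rho - 1 := by linear_combination (rho + 1 : ℂ) * h3
  have h5 : (rho + 1 : ℂ) ^ 5 = -rho := by linear_combination (rho + 1 : ℂ) ^ 2 * h3 - h2
  interval_cases l
  · exact him (by simpa using congrArg Complex.im hone)
  · exact him (by simpa [h2] using congrArg Complex.im hone)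
  · rw [h3] at hone
    norm_num at hone
  · exact him (by simpa [h4] using congrArg Complex.im hone)
  · exact him (by simpa [h5] using congrArg Complex.im hone)

theorem rho_add_one_mem_stabFactors : (rho + 1 : ℂ) ∈ stabFactors rho := by
  obtain ⟨γ, hγ⟩ : ∃ γ : SL(2, ℤ), (γ : Matrix (Fin 2) (Fin 2) ℤ) = !![0, -1; 1, 1] :=
    ⟨⟨!![0, -1; 1, 1], by simp [Matrix.det_fin_two_of]⟩, rfl⟩
  refine ⟨γ, ?_, by rw [ModularGroup.denom_apply]; simp [hγ]⟩
  have hne : (rho + 1 : ℂ) ≠ 0 := isPrimitiveRoot_rho_add_one.ne_zero (by norm_num)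
  ext1
  rw [UpperHalfPlane.specialLinearGroup_apply]
  simp only [hγ]
  simp
  field_simp
  linear_combination -rho_sq_add_rho_add_one

/-- In each case a primitive k-th root of unity is an automorphy factor of the stabilizer: i at i, ρ
+ 1 at ρ, and -1 everywhere. Its powers give all the others. -/
theorem mem_stabFactors_of_pow_eq_one {τ : ℍ} {ζ : ℂ} (h : ζ ^ kExp τ = 1) :
    ζ ∈ stabFactors τ := by
  have key : ∀ {u : ℂ} {k : ℕ} [NeZero k], IsPrimitiveRoot u k → u ∈ stabFactors τ → ζ ^ k = 1 →
      ζ ∈ stabFactors τ := fun hu hm hk => by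
    obtain ⟨i, -, hi⟩ := hu.eq_pow_of_pow_eq_one hk
    exact hi ▸ pow_mem_stabFactors hm i
  rw [kExp] at h
  split_ifs at h with h1 h2
  · obtain ⟨σ, rfl⟩ := h1
    exact key Complex.isPrimitiveRoot_I (stabFactors_smul I_mem_stabFactors σ) h
  · obtain ⟨σ, rfl⟩ := h2
    exact key isPrimitiveRoot_rho_add_one (stabFactors_smul rho_add_one_mem_stabFactors σ) h
  · exact key (IsPrimitiveRoot.neg_one 0 (by norm_num)) (neg_one_mem_stabFactors τ) h

/-- The condition of the third kind implies equality of the functions. -/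
theorem fFun_eqOn_of_sl {τ₀ : ℍ} {ω₀ ω₁ : ℂ} (hω₀ : ω₀ ≠ 0) (γ : SL(2, ℤ))
    (h : ω₁ ^ kExp τ₀ = denom γ τ₀ ^ kExp τ₀ * ω₀ ^ kExp τ₀) :
    disc τ₀ ω₀ = disc (γ • τ₀) ω₁ ∧ Set.EqOn (fFun τ₀ ω₀) (fFun (γ • τ₀) ω₁) (disc τ₀ ω₀) := by
  have hj : denom γ τ₀ * ω₀ ≠ 0 := mul_ne_zero (denom_ne_zero _ _) hω₀
  -- The quotient is a k-th root of unity, so replacing γ by γδ with δ fixing τ₀ makes it 1.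
  obtain ⟨δ, h1, h2⟩ := mem_stabFactors_of_pow_eq_one (τ := τ₀) (ζ := ω₁ / (denom γ τ₀ * ω₀)) (by
    rw [div_pow, mul_pow, h, div_self]
    rw [← mul_pow]
    exact pow_ne_zero _ hj)
  have h3 : ω₁ = denom ((γ * δ : SL(2, ℤ))) τ₀ * ω₀ := by
    rw [denom_mul, h1, h2]
    field_simp
  have h4 : γ • τ₀ = (γ * δ) • τ₀ := by rw [mul_smul, h1]
  rw [h3, h4]
  exact ⟨(disc_smul _ _ _).symm, eqOn_fFun_smul _ _ hω₀⟩

/-! ### The potential `½ t₁² t + t₁ t₂² + t₂⁴ f(t)` -/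

/-- The linear form with given coefficients. -/
def linForm (a : Fin 3 → ℂ) : (Fin 3 → ℂ) →L[ℂ] ℂ :=
  ∑ i, a i • ContinuousLinearMap.proj (R := ℂ) (φ := fun _ : Fin 3 => ℂ) i

theorem linForm_apply (a v : Fin 3 → ℂ) : linForm a v = a 0 * v 0 + a 1 * v 1 + a 2 * v 2 := by
  simp [linForm, Fin.sum_univ_three]

/-- The potential attached to a function of one variable. -/
def pot (f : ℂ → ℂ) (x : Fin 3 → ℂ) : ℂ :=
  1 / 2 * x 0 ^ 2 * x 2 + x 0 * x 1 ^ 2 + x 1 ^ 4 * f (x 2)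

/-- The first derivatives of the potential. -/
def potGrad (f : ℂ → ℂ) (x : Fin 3 → ℂ) : Fin 3 → ℂ :=
  ![x 0 * x 2 + x 1 ^ 2, 2 * (x 0 * x 1) + 4 * (x 1 ^ 3 * f (x 2)),
    1 / 2 * x 0 ^ 2 + x 1 ^ 4 * deriv f (x 2)]

/-- The second derivatives of the potential. -/
def potHess (f : ℂ → ℂ) (x : Fin 3 → ℂ) : Fin 3 → Fin 3 → ℂ :=
  ![![x 2, 2 * x 1, x 0],
    ![2 * x 1, 2 * x 0 + 12 * (x 1 ^ 2 * f (x 2)), 4 * (x 1 ^ 3 * deriv f (x 2))],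
    ![x 0, 4 * (x 1 ^ 3 * deriv f (x 2)), x 1 ^ 4 * deriv (deriv f) (x 2)]]

/-- The third derivatives of the potential. -/
def potThird (f : ℂ → ℂ) (x : Fin 3 → ℂ) : Fin 3 → Fin 3 → Fin 3 → ℂ :=
  ![![![0, 0, 1], ![0, 2, 0], ![1, 0, 0]],
    ![![0, 2, 0], ![2, 24 * (x 1 * f (x 2)), 12 * (x 1 ^ 2 * deriv f (x 2))],
      ![0, 12 * (x 1 ^ 2 * deriv f (x 2)), 4 * (x 1 ^ 3 * deriv (deriv f) (x 2))]],
    ![![1, 0, 0], ![0, 12 * (x 1 ^ 2 * deriv f (x 2)), 4 * (x 1 ^ 3 * deriv (deriv f) (x 2))],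
      ![0, 4 * (x 1 ^ 3 * deriv (deriv f) (x 2)), x 1 ^ 4 * deriv (deriv (deriv f)) (x 2)]]]

theorem hasFDerivAt_coord (i : Fin 3) (x : Fin 3 → ℂ) :
    HasFDerivAt (fun y : Fin 3 → ℂ => y i)
      (ContinuousLinearMap.proj (R := ℂ) (φ := fun _ : Fin 3 => ℂ) i) x :=
  (ContinuousLinearMap.proj (R := ℂ) (φ := fun _ : Fin 3 => ℂ) i).hasFDerivAt

theorem hasFDerivAt_pow_mul (n : ℕ) {g : ℂ → ℂ} {x : Fin 3 → ℂ} (hg : DifferentiableAt ℂ g (x 2)) :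
    HasFDerivAt (fun y : Fin 3 → ℂ => y 1 ^ n * g (y 2))
      (linForm ![0, n * x 1 ^ (n - 1) * g (x 2), x 1 ^ n * deriv g (x 2)]) x := by
  have h := ((hasFDerivAt_coord 1 x).pow n).mul
    (hg.hasDerivAt.comp_hasFDerivAt x (hasFDerivAt_coord 2 x))
  refine h.congr_fderiv ?_
  ext v
  simp [linForm_apply]
  ring

section Derivatives

variable {D : Set ℂ} {f : ℂ → ℂ}

theorem hasFDerivAt_pot {x : Fin 3 → ℂ} (hf : DifferentiableAt ℂ f (x 2)) :
    HasFDerivAt (pot f) (linForm (potGrad f x)) x := by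
  have h0 := hasFDerivAt_coord 0 x
  have h1 := hasFDerivAt_coord 1 x
  have h2 := hasFDerivAt_coord 2 x
  refine (((((h0.pow 2).const_mul (1 / 2)).mul h2).add (h0.mul (h1.pow 2))).add
    (hasFDerivAt_pow_mul 4 hf)).congr_fderiv ?_
  ext v
  simp [linForm_apply, potGrad]
  ring

theorem hasFDerivAt_potGrad {x : Fin 3 → ℂ} (hf : DifferentiableAt ℂ f (x 2))
    (hf' : DifferentiableAt ℂ (deriv f) (x 2)) (k : Fin 3) :
    HasFDerivAt (fun y => potGrad f y k) (linForm fun j => potHess f x j k) x := by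
  have h0 := hasFDerivAt_coord 0 x
  have h1 := hasFDerivAt_coord 1 x
  have h2 := hasFDerivAt_coord 2 x
  fin_cases k
  · refine ((h0.mul h2).add (h1.pow 2)).congr_fderiv ?_
    ext v
    simp [linForm_apply, potHess]
    ring
  · refine (((h0.mul h1).const_mul 2).add ((hasFDerivAt_pow_mul 3 hf).const_mul 4)).congr_fderiv ?_
    ext v
    simp [linForm_apply, potHess]
    ring
  · refine (((h0.pow 2).const_mul (1 / 2)).add (hasFDerivAt_pow_mul 4 hf')).congr_fderiv ?_
    ext v
    simp [linForm_apply, potHess]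
    ring

theorem hasFDerivAt_potHess {x : Fin 3 → ℂ} (hf : DifferentiableAt ℂ f (x 2))
    (hf' : DifferentiableAt ℂ (deriv f) (x 2)) (hf'' : DifferentiableAt ℂ (deriv (deriv f)) (x 2))
    (j k : Fin 3) :
    HasFDerivAt (fun y => potHess f y j k) (linForm fun i => potThird f x i j k) x := by
  have h0 := hasFDerivAt_coord 0 x
  have h1 := hasFDerivAt_coord 1 x
  have h2 := hasFDerivAt_coord 2 x
  have h3 := (hasFDerivAt_pow_mul 3 hf').const_mul 4
  fin_cases j <;> fin_cases k
  · refine h2.congr_fderiv ?_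
    ext v
    simp [linForm_apply, potThird]
  · refine (h1.const_mul 2).congr_fderiv ?_
    ext v
    simp [linForm_apply, potThird]
  · refine h0.congr_fderiv ?_
    ext v
    simp [linForm_apply, potThird]
  · refine (h1.const_mul 2).congr_fderiv ?_
    ext v
    simp [linForm_apply, potThird]
  · refine ((h0.const_mul 2).add ((hasFDerivAt_pow_mul 2 hf).const_mul 12)).congr_fderiv ?_
    ext v
    simp [linForm_apply, potThird]
    ring
  · refine h3.congr_fderiv ?_
    ext v
    simp [linForm_apply, potThird]
    ring
  · refine h0.congr_fderiv ?_
    ext v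
    simp [linForm_apply, potThird]
  · refine h3.congr_fderiv ?_
    ext v
    simp [linForm_apply, potThird]
    ring
  · refine (hasFDerivAt_pow_mul 4 hf'').congr_fderiv ?_
    ext v
    simp [linForm_apply, potThird, mul_assoc]

theorem pderiv_eq_of_eqOn {U : Set (Fin 3 → ℂ)} (hU : IsOpen U) {F G : (Fin 3 → ℂ) → ℂ}
    {a : Fin 3 → ℂ} {x : Fin 3 → ℂ} (hx : x ∈ U) (hFG : Set.EqOn F G U)
    (hG : HasFDerivAt G (linForm a) x) (i : Fin 3) : pderiv i F x = a i := by
  rw [pderiv, (hG.congr_of_eventuallyEq (hFG.eventuallyEq_of_mem (hU.mem_nhds hx))).fderiv,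
    linForm_apply]
  fin_cases i <;> simp

/-- The open set `ℂ² × D`. -/
def cyl (D : Set ℂ) : Set (Fin 3 → ℂ) := {x | x 2 ∈ D}

theorem isOpen_cyl (hD : IsOpen D) : IsOpen (cyl D) := hD.preimage (continuous_apply 2)

variable (hD : IsOpen D) (hf : DifferentiableOn ℂ f D)

include hD hf

theorem pderiv₃_pot {x : Fin 3 → ℂ} (hx : x ∈ cyl D) (i j k : Fin 3) :
    pderiv₃ (pot f) i j k x = potThird f x i j k := by
  have d0 : ∀ y ∈ cyl D, DifferentiableAt ℂ f (y 2) := fun y hy =>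
    hf.differentiableAt (hD.mem_nhds hy)
  have d1 : ∀ y ∈ cyl D, DifferentiableAt ℂ (deriv f) (y 2) := fun y hy =>
    (hf.deriv hD).differentiableAt (hD.mem_nhds hy)
  have d2 : ∀ y ∈ cyl D, DifferentiableAt ℂ (deriv (deriv f)) (y 2) := fun y hy =>
    ((hf.deriv hD).deriv hD).differentiableAt (hD.mem_nhds hy)
  have hU := isOpen_cyl hD
  have e1 : Set.EqOn (pderiv k (pot f)) (fun y => potGrad f y k) (cyl D) := fun y hy =>
    pderiv_eq_of_eqOn hU hy (fun _ _ => rfl) (hasFDerivAt_pot (d0 y hy)) k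
  have e2 : Set.EqOn (pderiv j (pderiv k (pot f))) (fun y => potHess f y j k) (cyl D) :=
    fun y hy => pderiv_eq_of_eqOn hU hy e1 (hasFDerivAt_potGrad (d0 y hy) (d1 y hy) k) j
  exact pderiv_eq_of_eqOn hU hx e2 (hasFDerivAt_potHess (d0 x hx) (d1 x hx) (d2 x hx) j k) i

theorem etaMatrix_pot {x : Fin 3 → ℂ} (hx : x ∈ cyl D) :
    etaMatrix (pot f) 0 x = !![0, 0, 1; 0, 2, 0; 1, 0, 0] := by
  ext i j
  rw [etaMatrix, Matrix.of_apply, pderiv₃_pot hD hf hx]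
  fin_cases i <;> fin_cases j <;> rfl

theorem etaMatrix_pot_inv {x : Fin 3 → ℂ} (hx : x ∈ cyl D) :
    (etaMatrix (pot f) 0 x)⁻¹ = !![0, 0, 1; 0, 1 / 2, 0; 1, 0, 0] := by
  rw [etaMatrix_pot hD hf hx]
  refine Matrix.inv_eq_right_inv ?_
  ext i j
  fin_cases i <;> fin_cases j <;> simp [Matrix.mul_apply, Fin.sum_univ_three]

end Derivatives

/-- The Frobenius data of the potential `pot f`. -/
def potData (D : Set ℂ) (f : ℂ → ℂ) : FrobeniusData (Fin 3) :=
  ofPotential (cyl D) (pot f) 0 (fun x => ![x 0, 1 / 2 * x 1, 0])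

theorem frobM_eq_potData (τ : ℍ) (ω : ℂ) : frobM τ ω = potData (disc τ ω) (fFun τ ω) := rfl

/-- The components of the product in terms of `f` and its derivatives. -/
def mulVec (f : ℂ → ℂ) (v w x : Fin 3 → ℂ) : Fin 3 → ℂ :=
  ![v 0 * w 0 + 12 * (v 1 * w 1) * (x 1 ^ 2 * deriv f (x 2))
      + 4 * (v 1 * w 2 + v 2 * w 1) * (x 1 ^ 3 * deriv (deriv f) (x 2))
      + v 2 * w 2 * (x 1 ^ 4 * deriv (deriv (deriv f)) (x 2)),
    v 0 * w 1 + v 1 * w 0 + 12 * (v 1 * w 1) * (x 1 ^ 1 * f (x 2))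
      + 6 * (v 1 * w 2 + v 2 * w 1) * (x 1 ^ 2 * deriv f (x 2))
      + 2 * (v 2 * w 2) * (x 1 ^ 3 * deriv (deriv f) (x 2)),
    v 0 * w 2 + v 2 * w 0 + 2 * (v 1 * w 1)]

/-- The directional derivative of `mulVec`. -/
def mulVecDeriv (f : ℂ → ℂ) (v w x u : Fin 3 → ℂ) : Fin 3 → ℂ :=
  ![12 * (v 1 * w 1) * (2 * x 1 * deriv f (x 2) * u 1 + x 1 ^ 2 * deriv (deriv f) (x 2) * u 2)
      + 4 * (v 1 * w 2 + v 2 * w 1) * (3 * x 1 ^ 2 * deriv (deriv f) (x 2) * u 1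
        + x 1 ^ 3 * deriv (deriv (deriv f)) (x 2) * u 2)
      + v 2 * w 2 * (4 * x 1 ^ 3 * deriv (deriv (deriv f)) (x 2) * u 1
        + x 1 ^ 4 * deriv (deriv (deriv (deriv f))) (x 2) * u 2),
    12 * (v 1 * w 1) * (f (x 2) * u 1 + x 1 * deriv f (x 2) * u 2)
      + 6 * (v 1 * w 2 + v 2 * w 1) * (2 * x 1 * deriv f (x 2) * u 1
        + x 1 ^ 2 * deriv (deriv f) (x 2) * u 2)
      + 2 * (v 2 * w 2) * (3 * x 1 ^ 2 * deriv (deriv f) (x 2) * u 1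
        + x 1 ^ 3 * deriv (deriv (deriv f)) (x 2) * u 2),
    0]

/-! ### The Frobenius axioms for the potential. -/

section Structure

variable {D : Set ℂ} {f : ℂ → ℂ} (hD : IsOpen D) (hf : DifferentiableOn ℂ f D)

include hD hf

theorem potData_metric {x : Fin 3 → ℂ} (hx : x ∈ cyl D) (v w : Fin 3 → ℂ) :
    (potData D f).metric x v w = v 0 * w 2 + 2 * (v 1 * w 1) + v 2 * w 0 := by
  change ∑ i, ∑ j, v i * w j * etaMatrix (pot f) 0 x i j = _
  rw [etaMatrix_pot hD hf hx]
  simp [Fin.sum_univ_three]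
  ring

theorem potData_mul {x : Fin 3 → ℂ} (hx : x ∈ cyl D) (v w : Fin 3 → ℂ) :
    (potData D f).mul x v w = mulVec f v w x := by
  change (fun k => ∑ i, ∑ j, v i * w j * structConst (pot f) 0 x i j k) = _
  have h : ∀ i j k, structConst (pot f) 0 x i j k
      = ∑ l, (!![0, 0, 1; 0, 1 / 2, 0; 1, 0, 0] : Matrix (Fin 3) (Fin 3) ℂ) k l
        * potThird f x i j l := fun i j k => by
    simp only [structConst, etaMatrix_pot_inv hD hf hx, pderiv₃_pot hD hf hx]
  funext k
  simp only [h, Fin.sum_univ_three]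
  fin_cases k <;> simp [potThird, mulVec] <;> ring

theorem hasFDerivAt_mulVec {x : Fin 3 → ℂ} (hx : x ∈ cyl D) (v w : Fin 3 → ℂ) :
    ∃ A : (Fin 3 → ℂ) →L[ℂ] (Fin 3 → ℂ), HasFDerivAt (mulVec f v w) A x ∧
      ∀ u, A u = mulVecDeriv f v w x u := by
  have hx' := hD.mem_nhds hx
  have d0 := hf.differentiableAt hx'
  have d1 := (hf.deriv hD).differentiableAt hx'
  have d2 := ((hf.deriv hD).deriv hD).differentiableAt hx'
  have d3 := (((hf.deriv hD).deriv hD).deriv hD).differentiableAt hx'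
  have c0 := ((((hasFDerivAt_pow_mul 2 d1).const_mul (12 * (v 1 * w 1))).const_add
    (v 0 * w 0)).add ((hasFDerivAt_pow_mul 3 d2).const_mul (4 * (v 1 * w 2 + v 2 * w 1)))).add
    ((hasFDerivAt_pow_mul 4 d3).const_mul (v 2 * w 2))
  -- The factor `x 1 ^ 1` in `mulVec` is written so as to match this case n = 1.
  have c1 := ((((hasFDerivAt_pow_mul 1 d0).const_mul (12 * (v 1 * w 1))).const_add
    (v 0 * w 1 + v 1 * w 0)).add
    ((hasFDerivAt_pow_mul 2 d1).const_mul (6 * (v 1 * w 2 + v 2 * w 1)))).add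
    ((hasFDerivAt_pow_mul 3 d2).const_mul (2 * (v 2 * w 2)))
  have c2 := hasFDerivAt_const (𝕜 := ℂ) (v 0 * w 2 + v 2 * w 0 + 2 * (v 1 * w 1)) x
  obtain ⟨A0, hA0, e0⟩ : ∃ A : (Fin 3 → ℂ) →L[ℂ] ℂ,
      HasFDerivAt (fun y => mulVec f v w y 0) A x ∧ ∀ u, A u = mulVecDeriv f v w x u 0 :=
    ⟨_, c0, fun u => by simp [linForm_apply, mulVecDeriv]⟩
  obtain ⟨A1, hA1, e1⟩ : ∃ A : (Fin 3 → ℂ) →L[ℂ] ℂ,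
      HasFDerivAt (fun y => mulVec f v w y 1) A x ∧ ∀ u, A u = mulVecDeriv f v w x u 1 :=
    ⟨_, c1, fun u => by simp [linForm_apply, mulVecDeriv]⟩
  obtain ⟨A2, hA2, e2⟩ : ∃ A : (Fin 3 → ℂ) →L[ℂ] ℂ,
      HasFDerivAt (fun y => mulVec f v w y 2) A x ∧ ∀ u, A u = mulVecDeriv f v w x u 2 :=
    ⟨_, c2, fun u => by simp [mulVecDeriv]⟩
  refine ⟨ContinuousLinearMap.pi ![A0, A1, A2], hasFDerivAt_pi.mpr fun i => ?_, fun u => ?_⟩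
  · fin_cases i
    exacts [hA0, hA1, hA2]
  · funext i
    fin_cases i
    exacts [e0 u, e1 u, e2 u]

theorem differentiableAt_potData_mul {x : Fin 3 → ℂ} (hx : x ∈ cyl D) (v w : Fin 3 → ℂ) :
    DifferentiableAt ℂ (fun y => (potData D f).mul y v w) x := by
  obtain ⟨A, hA, -⟩ := hasFDerivAt_mulVec hD hf hx v w
  refine hA.differentiableAt.congr_of_eventuallyEq ?_
  filter_upwards [(isOpen_cyl hD).mem_nhds hx] with y hy using potData_mul hD hf hy v w

theorem fderiv_potData_mul {x : Fin 3 → ℂ} (hx : x ∈ cyl D) (u v w : Fin 3 → ℂ) :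
    fderiv ℂ (fun y => (potData D f).mul y v w) x u = mulVecDeriv f v w x u := by
  obtain ⟨A, hA, hA'⟩ := hasFDerivAt_mulVec hD hf hx v w
  have h : (fun y => (potData D f).mul y v w) =ᶠ[𝓝 x] mulVec f v w := by
    filter_upwards [(isOpen_cyl hD).mem_nhds hx] with y hy using potData_mul hD hf hy v w
  rw [h.fderiv_eq, hA.fderiv, hA']

theorem hasFDerivAt_potData_metric {x : Fin 3 → ℂ} (hx : x ∈ cyl D) (v w : Fin 3 → ℂ) :
    HasFDerivAt (fun y => (potData D f).metric y v w) (0 : (Fin 3 → ℂ) →L[ℂ] ℂ) x := by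
  refine (hasFDerivAt_const (v 0 * w 2 + 2 * (v 1 * w 1) + v 2 * w 0) x).congr_of_eventuallyEq ?_
  filter_upwards [(isOpen_cyl hD).mem_nhds hx] with y hy using potData_metric hD hf hy v w

omit hD hf in
theorem hasFDerivAt_euler (x : Fin 3 → ℂ) :
    ∃ A : (Fin 3 → ℂ) →L[ℂ] (Fin 3 → ℂ), HasFDerivAt (potData D f).euler A x ∧
      ∀ u, A u = ![u 0, 1 / 2 * u 1, 0] := by
  have h0 := hasFDerivAt_coord 0 x
  have h1 := (hasFDerivAt_coord 1 x).const_mul (1 / 2)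
  have h2 := hasFDerivAt_const (𝕜 := ℂ) (0 : ℂ) x
  refine ⟨ContinuousLinearMap.pi ![linForm ![1, 0, 0], linForm ![0, 1 / 2, 0], 0],
    hasFDerivAt_pi.mpr fun i => ?_, fun u => ?_⟩
  · fin_cases i
    · exact h0.congr_fderiv (by ext v; simp [linForm_apply])
    · exact h1.congr_fderiv (by ext v; simp [linForm_apply])
    · exact h2
  · funext i
    fin_cases i <;> simp [linForm_apply]

omit hD hf in
theorem fderiv_euler (x u : Fin 3 → ℂ) :
    fderiv ℂ (potData D f).euler x u = ![u 0, 1 / 2 * u 1, 0] := by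
  obtain ⟨A, hA, hA'⟩ := hasFDerivAt_euler (D := D) (f := f) x
  rw [hA.fderiv, hA']

omit hD hf in
theorem convex_cyl (hc : Convex ℝ D) : Convex ℝ (cyl D) := by
  intro x hx y hy a b ha hb hab
  exact hc hx hy ha hb hab

omit hD hf in
theorem mulVec_assoc {x : Fin 3 → ℂ}
    (h3 : deriv (deriv (deriv f)) (x 2) + 24 * f (x 2) * deriv (deriv f) (x 2)
      - 36 * deriv f (x 2) ^ 2 = 0) (u v w : Fin 3 → ℂ) :
    mulVec f (mulVec f u v x) w x = mulVec f u (mulVec f v w x) x := by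
  have h : deriv (deriv (deriv f)) (x 2)
      = 36 * deriv f (x 2) ^ 2 - 24 * f (x 2) * deriv (deriv f) (x 2) := by
    linear_combination h3
  funext i
  fin_cases i <;> simp [mulVec, h] <;> ring

/-- The potential satisfies the associativity equations when `f` satisfies Chazy's equation. -/
theorem isFrobenius_potData (hne : D.Nonempty) (hc : Convex ℝ D)
    (hch : ∀ t ∈ D, chazy f t = 0) : IsFrobenius (potData D f) 1 := by
  have hmul : ∀ x ∈ cyl D, ∀ v w, (potData D f).mul x v w = mulVec f v w x :=
    fun x hx => potData_mul hD hf hx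
  have hmet : ∀ x ∈ cyl D, ∀ v w : Fin 3 → ℂ,
      (potData D f).metric x v w = v 0 * w 2 + 2 * (v 1 * w 1) + v 2 * w 0 :=
    fun x hx => potData_metric hD hf hx
  refine
    { isOpen_domain := isOpen_cyl hD
      isConnected_domain := ?_
      metric_holo := fun v w x hx =>
        (hasFDerivAt_potData_metric hD hf hx v w).differentiableAt.differentiableWithinAt
      mul_holo := fun v w x hx =>
        (differentiableAt_potData_mul hD hf hx v w).differentiableWithinAt
      unit_holo := differentiableOn_const _
      euler_holo := fun x _ => by
        obtain ⟨A, hA, -⟩ := hasFDerivAt_euler (D := D) (f := f) x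
        exact hA.differentiableAt.differentiableWithinAt
      metric_symm := fun x hx v w => by rw [hmet x hx, hmet x hx]; ring
      metric_nondeg := fun x hx v h => ?_
      mul_comm := fun x hx v w => ?_
      mul_assoc := fun x hx u v w => ?_
      unit_mul := fun x hx v => ?_
      invariant := fun x hx u v w => ?_
      -- The metric is constant in these coordinates, so its Christoffel symbols vanish.
      connection := ⟨fun _ => 0, ⟨?_, ?_, ?_⟩, ?_, ?_, ?_⟩
      lie_metric := fun x hx v w => ?_
      lie_mul := fun x hx v w => ?_ }
  · obtain ⟨t, ht⟩ := hne
    exact (convex_cyl hc).isConnected ⟨fun _ => t, ht⟩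
  · simp only [hmet x hx] at h
    have h0 := h (Pi.single 0 1)
    have h1 := h (Pi.single 1 1)
    have h2 := h (Pi.single 2 1)
    simp at h0 h1 h2
    funext i
    fin_cases i
    exacts [h2, h1, h0]
  · rw [hmul x hx, hmul x hx]
    funext i
    fin_cases i <;> simp [mulVec] <;> ring
  · simp only [hmul x hx]
    have h3 := hch _ hx
    rw [chazy_eq hD hf hx] at h3
    exact mulVec_assoc h3 u v w
  · rw [hmul x hx]
    funext i
    fin_cases i <;> simp [mulVec, potData, ofPotential]
  · simp only [hmul x hx, hmet x hx]
    simp [mulVec]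
    ring
  · exact fun v w => differentiableOn_const _
  · intros; rfl
  · intro x hx u v w
    rw [(hasFDerivAt_potData_metric hD hf hx v w).fderiv]
    simp
  · intro x hx u v w
    simp
  · intro x hx u v w
    rw [fderiv_potData_mul hD hf hx, fderiv_potData_mul hD hf hx]
    simp only [LinearMap.zero_apply, map_zero]
    funext i
    fin_cases i <;> simp [mulVecDeriv] <;> ring
  · intro x hx u
    have : (potData D f).unit = fun _ => Pi.single 0 1 := rfl
    rw [this]
    simp
  · rw [(hasFDerivAt_potData_metric hD hf hx v w).fderiv, fderiv_euler, fderiv_euler,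
      hmet x hx, hmet x hx, hmet x hx]
    simp
    ring
  · rw [fderiv_potData_mul hD hf hx, fderiv_euler, fderiv_euler, fderiv_euler]
    simp only [hmul x hx]
    funext i
    fin_cases i <;> simp [mulVec, mulVecDeriv, potData, ofPotential] <;> ring

end Structure

/-! ### Isomorphisms -/

theorem isomorphic_of_eqOn {D : Set ℂ} {f g : ℂ → ℂ} (hD : IsOpen D)
    (hf : DifferentiableOn ℂ f D) (hg : DifferentiableOn ℂ g D) (h : Set.EqOn f g D) :
    Isomorphic (potData D f) (potData D g) := by
  have h1 : Set.EqOn (deriv f) (deriv g) D := h.deriv hD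
  have h2 := h1.deriv hD
  have h3 := h2.deriv hD
  refine ⟨id, id, fun x hx => hx, fun x hx => hx, fun _ _ => rfl, fun _ _ => rfl,
    differentiableOn_id, differentiableOn_id, fun x hx => ?_⟩
  have hx' : x 2 ∈ D := hx
  rw [fderiv_id]
  refine ⟨fun v w => ?_, fun v w => ?_, rfl, rfl⟩
  · exact (potData_metric hD hg hx v w).trans (potData_metric hD hf hx v w).symm
  · refine (potData_mul hD hf hx v w).trans (Eq.trans ?_ (potData_mul hD hg hx v w).symm)
    simp only [mulVec, h hx', h1 hx', h2 hx', h3 hx']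

theorem clm_apply_eq_sum (A : (Fin 3 → ℂ) →L[ℂ] (Fin 3 → ℂ)) (w : Fin 3 → ℂ) (j : Fin 3) :
    A w j = w 0 * A (Pi.single 0 1) j + w 1 * A (Pi.single 1 1) j
      + w 2 * A (Pi.single 2 1) j := by
  have h : w = w 0 • Pi.single 0 1 + w 1 • Pi.single 1 1 + w 2 • Pi.single 2 1 := by
    funext i
    fin_cases i <;> simp
  conv_lhs => rw [h]
  simp

/-- An isomorphism acts on the last flat coordinate by a translation, which carries one function
to the other. -/
theorem exists_translation_of_isomorphic {D₀ D₁ : Set ℂ} {f₀ f₁ : ℂ → ℂ} (hD₀ : IsOpen D₀)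
    (hD₁ : IsOpen D₁) (hf₀ : DifferentiableOn ℂ f₀ D₀) (hf₁ : DifferentiableOn ℂ f₁ D₁)
    (hc : Convex ℝ D₀) (hne : D₀.Nonempty) (h : Isomorphic (potData D₀ f₀) (potData D₁ f₁)) :
    ∃ b : ℂ, (∀ t ∈ D₀, t + b ∈ D₁ ∧ f₀ t = f₁ (t + b)) ∧ ∀ t ∈ D₁, t - b ∈ D₀ := by
  obtain ⟨φ, ψ, hφ, hψ, -, hφψ, dφ, -, H⟩ := h
  have hφ : ∀ x ∈ cyl D₀, φ x ∈ cyl D₁ := hφ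
  have hψ : ∀ x ∈ cyl D₁, ψ x ∈ cyl D₀ := hψ
  have hφψ : ∀ x ∈ cyl D₁, φ (ψ x) = x := hφψ
  have dφ : ∀ x ∈ cyl D₀, HasFDerivAt φ (fderiv ℂ φ x) x := fun x hx =>
    (dφ.differentiableAt ((isOpen_cyl hD₀).mem_nhds hx)).hasFDerivAt
  have hmet : ∀ x ∈ cyl D₀, ∀ v w : Fin 3 → ℂ, fderiv ℂ φ x v 0 * fderiv ℂ φ x w 2
      + 2 * (fderiv ℂ φ x v 1 * fderiv ℂ φ x w 1) + fderiv ℂ φ x v 2 * fderiv ℂ φ x w 0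
      = v 0 * w 2 + 2 * (v 1 * w 1) + v 2 * w 0 := fun x hx v w => by
    rw [← potData_metric hD₀ hf₀ hx v w, ← potData_metric hD₁ hf₁ (hφ x hx)]
    exact (H x hx).1 v w
  have hunit : ∀ x ∈ cyl D₀, fderiv ℂ φ x (Pi.single 0 1) = Pi.single 0 1 := fun x hx =>
    (H x hx).2.2.1
  -- The last component is η(e, ·), and both η and e are preserved.
  have hlast : ∀ x ∈ cyl D₀, ∀ w : Fin 3 → ℂ, fderiv ℂ φ x w 2 = w 2 := fun x hx w => by
    have := hmet x hx (Pi.single 0 1) w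
    simpa [hunit x hx] using this
  obtain ⟨t₀, ht₀⟩ := hne
  obtain ⟨b, hb⟩ : ∃ b : ℂ, ∀ x ∈ cyl D₀, φ x 2 = x 2 + b := by
    have hd : ∀ x ∈ cyl D₀, HasFDerivAt (fun y => φ y 2 - y 2) (0 : (Fin 3 → ℂ) →L[ℂ] ℂ) x :=
      fun x hx => by
        refine ((hasFDerivAt_pi'.mp (dφ x hx) 2).sub (hasFDerivAt_coord 2 x)).congr_fderiv ?_
        ext w
        simp [hlast x hx]
    have hx₀ : (fun _ => t₀ : Fin 3 → ℂ) ∈ cyl D₀ := ht₀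
    refine ⟨φ (fun _ => t₀) 2 - t₀, fun x hx => ?_⟩
    have := (isOpen_cyl hD₀).is_const_of_fderiv_eq_zero (𝕜 := ℂ)
      (convex_cyl hc).isPreconnected
      (fun y hy => (hd y hy).differentiableAt.differentiableWithinAt)
      (fun y hy => (hd y hy).fderiv) hx hx₀
    linear_combination this
  have hsq : ∀ x ∈ cyl D₀, fderiv ℂ φ x (Pi.single 1 1) 1 ^ 2 = 1 := fun x hx => by
    have := hmet x hx (Pi.single 1 1) (Pi.single 1 1)
    simp [hlast x hx] at this
    rw [sq]
    exact this
  -- Middle component of dφ(E) = E; the ∂₁ part of E contributes nothing since dφ fixes ∂₁.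
  have heul : ∀ x ∈ cyl D₀, φ x 1 = x 1 * fderiv ℂ φ x (Pi.single 1 1) 1 := fun x hx => by
    have h1 : fderiv ℂ φ x ![x 0, 1 / 2 * x 1, 0] = ![φ x 0, 1 / 2 * φ x 1, 0] := (H x hx).2.2.2
    have h2 := congr_fun h1 1
    rw [clm_apply_eq_sum, hunit x hx] at h2
    simp at h2
    linear_combination (-2) * h2
  have hφ1 : ∀ x ∈ cyl D₀, φ x 1 ^ 2 = x 1 ^ 2 := fun x hx => by
    rw [heul x hx, mul_pow, hsq x hx, mul_one]
  refine ⟨b, fun t ht => ?_, fun t ht => ?_⟩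
  -- At t₂ = 1 the value f₀(t) can be read off from the middle component 12 t₂ f₀(t) of ∂₂ ∘ ∂₂.
  · have hx : (![0, 1, t] : Fin 3 → ℂ) ∈ cyl D₀ := ht
    generalize hxdef : (![0, 1, t] : Fin 3 → ℂ) = x at hx
    have x1 : x 1 = 1 := by simp [← hxdef]
    have x2 : x 2 = t := by simp [← hxdef]
    have hφx := hφ x hx
    have hb' := hb x hx
    rw [x2] at hb'
    refine ⟨hb' ▸ hφx, ?_⟩
    set A := fderiv ℂ φ x with hA
    have hA2 : ∀ w, A w 2 = w 2 := hlast x hx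
    have hβ : A (Pi.single 1 1) 1 ^ 2 = 1 := hsq x hx
    have hβ0 : A (Pi.single 1 1) 1 ≠ 0 := fun h0 => by simp [h0] at hβ
    have hφ1x : φ x 1 = A (Pi.single 1 1) 1 := by rw [heul x hx, x1, one_mul]
    -- Differentiate φ₁² = x₁² along t, where φ₁ = ±1 is nonzero.
    have hA21 : A (Pi.single 2 1) 1 = 0 := by
      have d1 := (hasFDerivAt_pi'.mp (dφ x hx) 1).pow 2
      have d2 := (hasFDerivAt_coord 1 x).pow 2
      have hev : (fun y => φ y 1 ^ 2) =ᶠ[𝓝 x] fun y => y 1 ^ 2 := by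
        filter_upwards [(isOpen_cyl hD₀).mem_nhds hx] with y hy using hφ1 y hy
      have := congr_arg (fun L => L (Pi.single 2 1)) (d1.unique (d2.congr_of_eventuallyEq hev))
      simp [hφ1x] at this
      exact this.resolve_left hβ0
    have hA10 : A (Pi.single 1 1) 0 = 0 := by
      have := hmet x hx (Pi.single 1 1) (Pi.single 2 1)
      simpa [← hA, hA2, hA21] using this
    have hmul : A (mulVec f₀ (Pi.single 1 1) (Pi.single 1 1) x)
        = mulVec f₁ (A (Pi.single 1 1)) (A (Pi.single 1 1)) (φ x) := by
      rw [← potData_mul hD₀ hf₀ hx, ← potData_mul hD₁ hf₁ hφx]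
      exact (H x hx).2.1 _ _
    have hmul1 := congr_fun hmul 1
    rw [clm_apply_eq_sum, hA21, hunit x hx] at hmul1
    simp [mulVec, hA10, hA2, x1, x2, hb', hφ1x] at hmul1
    -- With β the middle component of dφ(∂₂), the product gives βf₀ = β³f₁, and β² = 1.
    have key : A (Pi.single 1 1) 1 * (f₀ t - f₁ (t + b)) = 0 := by
      linear_combination (1 / 12) * hmul1
        + A (Pi.single 1 1) 1 * f₁ (t + b) * hβ
    exact sub_eq_zero.mp ((mul_eq_zero.mp key).resolve_left hβ0)
  · have hx : (![0, 1, t] : Fin 3 → ℂ) ∈ cyl D₁ := ht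
    have h1 := hb _ (hψ _ hx)
    rw [hφψ _ hx] at h1
    have h2 : t - b = ψ ![0, 1, t] 2 := by
      rw [sub_eq_iff_eq_add]
      exact h1
    rw [h2]
    exact hψ _ hx

theorem add_norm_le_of_translate_ball_subset {R₀ R₁ : ℝ} (hR₀ : 0 < R₀) {b : ℂ}
    (h : ∀ t ∈ Metric.ball (0 : ℂ) R₀, t + b ∈ Metric.ball (0 : ℂ) R₁) : R₀ + ‖b‖ ≤ R₁ := by
  obtain ⟨u, hu, hbu⟩ : ∃ u : ℂ, ‖u‖ = 1 ∧ b = ‖b‖ * u := by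
    rcases eq_or_ne b 0 with rfl | hb
    · exact ⟨1, by simp, by simp⟩
    · have hb' : (‖b‖ : ℂ) ≠ 0 := by exact_mod_cast norm_ne_zero_iff.mpr hb
      refine ⟨b / ‖b‖, ?_, by field_simp⟩
      rw [norm_div, Complex.norm_real, norm_norm, div_self (norm_ne_zero_iff.mpr hb)]
  refine le_of_forall_lt_imp_le_of_dense fun c hc => ?_
  -- The test point is r·u in the direction u of b, which the translation moves to distance r + ‖b‖;
  -- the maximum with 0 covers c < ‖b‖.
  have hr0 : 0 ≤ max 0 (c - ‖b‖) := le_max_left _ _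
  have hr : max 0 (c - ‖b‖) < R₀ := max_lt hR₀ (by linarith)
  generalize hrdef : max 0 (c - ‖b‖) = r at hr0 hr
  have hcr : c ≤ r + ‖b‖ := by
    have := le_max_right 0 (c - ‖b‖)
    linarith
  have h1 := h (r * u) (by simpa [hu, abs_of_nonneg hr0] using hr)
  have h2 : (r : ℂ) * u + b = ((r + ‖b‖ : ℝ) : ℂ) * u := by
    conv_lhs => rw [hbu]
    push_cast
    ring
  rw [h2, mem_ball_zero_iff, norm_mul, hu, mul_one, Complex.norm_real,
    Real.norm_of_nonneg (by positivity)] at h1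
  linarith

/-- Translation by b and by -b map the discs into each other, so R₀ + |b| ≤ R₁ and R₁ + |b| ≤ R₀,
which forces b = 0. -/
theorem eqOn_of_isomorphic_ball {R₀ R₁ : ℝ} (hR₀ : 0 < R₀) (hR₁ : 0 < R₁) {f₀ f₁ : ℂ → ℂ}
    (hf₀ : DifferentiableOn ℂ f₀ (Metric.ball 0 R₀))
    (hf₁ : DifferentiableOn ℂ f₁ (Metric.ball 0 R₁))
    (h : Isomorphic (potData (Metric.ball 0 R₀) f₀) (potData (Metric.ball 0 R₁) f₁)) :
    R₀ = R₁ ∧ Set.EqOn f₀ f₁ (Metric.ball 0 R₀) := by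
  obtain ⟨b, h1, h2⟩ := exists_translation_of_isomorphic Metric.isOpen_ball Metric.isOpen_ball
    hf₀ hf₁ (convex_ball _ _) ⟨0, Metric.mem_ball_self hR₀⟩ h
  have h3 := add_norm_le_of_translate_ball_subset hR₀ fun t ht => (h1 t ht).1
  have h4 := add_norm_le_of_translate_ball_subset hR₁ (b := -b) fun t ht => by
    simpa [sub_eq_add_neg] using h2 t ht
  rw [norm_neg] at h4
  have h5 := norm_nonneg b
  have hb : b = 0 := norm_eq_zero.mp (by linarith)
  refine ⟨by linarith, fun t ht => ?_⟩
  simpa [hb] using (h1 t ht).2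

/-! ### The manifolds `M^{(τ,ω)}` -/

theorem isFrobenius_frobM (τ : ℍ) {ω : ℂ} (hω : ω ≠ 0) : IsFrobenius (frobM τ ω) 1 := by
  rw [frobM_eq_potData]
  refine isFrobenius_potData (isOpen_disc τ ω) (differentiableOn_fFun τ hω)
    ⟨0, zero_mem_disc τ hω⟩ ?_ fun t ht => chazy_fFun τ hω ht
  rw [disc_eq_ball]
  exact convex_ball _ _

theorem isomorphic_frobM_iff (τ₀ τ₁ : ℍ) {ω₀ ω₁ : ℂ} (hω₀ : ω₀ ≠ 0) (hω₁ : ω₁ ≠ 0) :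
    Isomorphic (frobM τ₀ ω₀) (frobM τ₁ ω₁) ↔
      disc τ₀ ω₀ = disc τ₁ ω₁ ∧ Set.EqOn (fFun τ₀ ω₀) (fFun τ₁ ω₁) (disc τ₀ ω₀) := by
  have d₀ := differentiableOn_fFun τ₀ hω₀
  have d₁ := differentiableOn_fFun τ₁ hω₁
  rw [frobM_eq_potData, frobM_eq_potData]
  constructor
  · intro h
    rw [disc_eq_ball] at d₀ d₁
    rw [disc_eq_ball, disc_eq_ball] at h ⊢
    obtain ⟨h1, h2⟩ := eqOn_of_isomorphic_ball (disc_radius_pos τ₀ hω₀) (disc_radius_pos τ₁ hω₁)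
      d₀ d₁ h
    exact ⟨by rw [h1], h2⟩
  · rintro ⟨h1, h2⟩
    rw [← h1] at d₁ ⊢
    exact isomorphic_of_eqOn (isOpen_disc τ₀ ω₀) d₀ d₁ h2

end FrobeniusManifolds

theorem mainTheorem2 (τ₀ τ₁ : UpperHalfPlane) (ω₀ ω₁ : ℂ) (hω₀ : ω₀ ≠ 0) (hω₁ : ω₁ ≠ 0) :
    FrobeniusManifolds.IsFrobenius (FrobeniusManifolds.frobM τ₀ ω₀) 1 ∧
    FrobeniusManifolds.IsFrobenius (FrobeniusManifolds.frobM τ₁ ω₁) 1 ∧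
    List.TFAE [
      FrobeniusManifolds.Isomorphic (FrobeniusManifolds.frobM τ₀ ω₀)
        (FrobeniusManifolds.frobM τ₁ ω₁),
      FrobeniusManifolds.disc τ₀ ω₀ = FrobeniusManifolds.disc τ₁ ω₁ ∧
        Set.EqOn (FrobeniusManifolds.fFun τ₀ ω₀) (FrobeniusManifolds.fFun τ₁ ω₁)
          (FrobeniusManifolds.disc τ₀ ω₀),
      FrobeniusManifolds.fFun τ₀ ω₀ =ᶠ[𝓝 0] FrobeniusManifolds.fFun τ₁ ω₁,
      ∃ γ : Matrix.SpecialLinearGroup (Fin 2) ℤ,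
        (τ₁ : ℂ) = ((γ 0 0 : ℤ) * (τ₀ : ℂ) + (γ 0 1 : ℤ)) / ((γ 1 0 : ℤ) * (τ₀ : ℂ) + (γ 1 1 : ℤ)) ∧
        ω₁ ^ FrobeniusManifolds.kExp τ₀ =
          ((γ 1 0 : ℤ) * (τ₀ : ℂ) + (γ 1 1 : ℤ)) ^ FrobeniusManifolds.kExp τ₀ *
            ω₀ ^ FrobeniusManifolds.kExp τ₀] := by
  open FrobeniusManifolds in
  refine ⟨isFrobenius_frobM τ₀ hω₀, isFrobenius_frobM τ₁ hω₁, ?_⟩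
  have hcoe : ∀ γ : SL(2, ℤ), ((γ • τ₀ : ℍ) : ℂ)
      = ((γ 0 0 : ℤ) * (τ₀ : ℂ) + (γ 0 1 : ℤ)) / ((γ 1 0 : ℤ) * (τ₀ : ℂ) + (γ 1 1 : ℤ)) :=
    fun γ => by simp [UpperHalfPlane.specialLinearGroup_apply]
  have hden : ∀ γ : SL(2, ℤ), UpperHalfPlane.denom γ τ₀ = (γ 1 0 : ℤ) * (τ₀ : ℂ) + (γ 1 1 : ℤ) :=
    fun γ => ModularGroup.denom_apply γ τ₀
  tfae_have 1 ↔ 2 := isomorphic_frobM_iff τ₀ τ₁ hω₀ hω₁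
  tfae_have 2 → 3 := fun h =>
    h.2.eventuallyEq_of_mem ((isOpen_disc τ₀ ω₀).mem_nhds (zero_mem_disc τ₀ hω₀))
  tfae_have 3 → 4 := fun h => by
    obtain ⟨γ, h1, h2⟩ := exists_sl_of_fFun_eventuallyEq hω₀ hω₁ h
    exact ⟨γ, by rw [h1, hcoe], by rw [h2, mul_pow, hden]⟩
  tfae_have 4 → 2 := by
    rintro ⟨γ, h1, h2⟩
    rw [← hcoe] at h1
    obtain rfl : τ₁ = γ • τ₀ := UpperHalfPlane.ext h1
    rw [← hden] at h2
    exact fFun_eqOn_of_sl hω₀ γ h2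
  tfae_finish

end
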